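/- **Setting.** Let $(\mathcal S,\mathcal A,\mathcal P,\rho,\gamma)$ be a discounted MDP with finite state and action spaces and $\gamma\in(0,1)$, let $\pi_\theta$ ($\theta\in\mathbb R^d$) be a class of stationary policies, and let $$d^{\pi_\theta}(s)=(1-\gamma)\sum_{t\ge 0}\gamma^t\,\mathbb P_{\rho,\pi_\theta}(s_t=s),\qquad \lambda^{\pi_\theta}(s,a)=d^{\pi_\theta}(s)\,\pi_\theta(a|s)$$ be the normalized occupancy measures. Let $F:\mathbb R^{\mathcal S\times\mathcal A}\to\mathbb R$ be a utility, and let $p_\omega\in\Delta(\mathcal S)$, $\omega\in\Omega\subseteq\mathbb R^m$, $m\ge 1$, be a parametric class of distributions. Let $\Lambda=\{p_\omega\cdot\pi_\theta:\omega\in\Omega,\theta\in\mathbb R^d\}$, where $(p_\omega\cdot\pi_\theta)(s,a)=p_\omega(s)\pi_\theta(a|s)$. **Assumptions.** 1. (Function class) $\Omega$ is compact with $\|\omega\|_\infty\le B_\omega$ on $\Omega$; for every $\theta$, $d^{\pi_\theta}=p_\omega$ for some $\omega\in\Omega$; and there is $L:\mathcal S\to\mathbb R$ with $\sum_s L(s)\le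 B_L$ and $|p_\omega(s)-p_{\bar\omega}(s)|\le L(s)\|\omega-\bar\omega\|_\infty$ for all $s$ and all $\omega,\bar\omega\in\Omega$. 2. (Policies) For all $(s,a)$: $\pi_\theta(a|s)>0$ for every $\theta$, $\theta\mapsto\pi_\theta(a|s)$ is $C^1$, and the score $\theta\mapsto\nabla_\theta\log\pi_\theta(a|s)$ is bounded by $B>0$ and Lipschitz with constant $L_\pi>0$. 3. (Utility) $F$ is differentiable at every point of $\Lambda$, and for all $\lambda_1,\lambda_2\in\Lambda$, $\|\nabla F(\lambda_1)\|_2\le l_\lambda$ and $\|\nabla F(\lambda_1)-\nabla F(\lambda_2)\|_2\le L_\lambda\|\lambda_1-\lambda_2\|_2$, where $l_\lambda,L_\lambda>0$. **Algorithm.** Start at $\theta_0\in\mathbb R^d$. At iteration $t=0,1,2,\dots$: - draw $n$ i.i.d. states $s_1,\dots,s_n$ from $d^{\pi_{\theta_t}}$; - take any maximum likelihood estimate $\hat\omega_t\in\arg\max_{\omega\in\Omega}\frac1n\sum_i\log p_\omega(s_i)$ and set $\hat\lambda_t=p_{\hat\omega_t}\cdot\pi_{\theta_t}$, $\hat r_t=\nabla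 F(\hat\lambda_t)$; - draw $N$ independent trajectories $\tau_t^{(i)}$ of length $H$ under $\pi_{\theta_t}$ with $s_0\sim\rho$; - set $\theta_{t+1}=\theta_t+\frac{\alpha}{N}\sum_{i=1}^N g(\tau^{(i)}_t,\theta_t,\hat r_t)$, where $$g(\tau,\theta,r)=\sum_{t=0}^{H-1}\Big(\sum_{h=t}^{H-1}\gamma^h r(s_h,a_h)\Big)\nabla_\theta\log\pi_\theta(a_t|s_t).$$ Let $0<\alpha\le 1/(2L_\theta)$ with $$L_\theta=\frac{L_\lambda B^2}{(1-\gamma)^4}+\frac{2B^2l_\lambda}{(1-\gamma)^3}+\frac{l_\lambda L_\pi}{(1-\gamma)^2},$$ assume that $\sup_\theta F(\lambda^{\pi_\theta})-F(\lambda^{\pi_{\theta_0}})\le\Delta<\infty$, and let $\tau$ be uniform on $\{1,\dots,T\}$, independent of the run. **Claim.** Under Assumptions 1–3, $\theta\mapsto F(\lambda^{\pi_\theta})$ is differentiable, and there are constants $C,C'>0$, depending only on $(\gamma,B,L_\pi,l_\lambda,L_\lambda,B_\omega,B_L,\Delta,\alpha)$ and not on $m$, $d$, $|\mathcal S|$,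 $|\mathcal A|$ or the problem, such that for every $\epsilon\in(0,1]$, whenever $$T\ge \frac C\epsilon,\qquad N\ge\frac C\epsilon,\qquad H\ge C\Big(1+\log\frac1\epsilon\Big),$$ and $$n\ge \frac{C\,m}{\epsilon}\,\log\!\Big(2+\frac m\epsilon\Big)\qquad\text{or}\qquad n\ge \frac{C\,|\mathcal S|\,m}{\epsilon},$$ it holds that $$\mathbb E\big[\|\nabla_\theta F(\lambda^{\pi_{\theta_\tau}})\|^2\big]\le\epsilon .$$ For the smallest integers $T,N,n$ allowed by these conditions, the total sample complexity $T(N+n)$ is at most $C'm\,\epsilon^{-2}\log(2+m/\epsilon)$ with the first choice of $n$, and at most $C'|\mathcal S|\,m\,\epsilon^{-2}$ with the second. That is, $n=\tilde{\mathcal O}(m\epsilon^{-1})$ and total complexity $\tilde{\mathcal O}(m\epsilon^{-2})$ uniformly in the size of the MDP, and $n=\mathcal O(m\epsilon^{-1})$ and $\mathcal O(m\epsilon^{-2})$ without logarithm when constants may depend on $|\mathcal S|$. -/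

import Mathlib

open scoped BigOperators

noncomputable section

/-- A reinforcement learning problem with general utility: a discounted MDP with state space `S` and
action space `A`, a policy class `θ ↦ π_θ` (`θ ∈ ℝ^d`), a utility `F` on `ℝ^{S × A}`, and a
parametric class `p_ω ∈ Δ(S)`, `ω ∈ Ω ⊆ ℝ^m`, used to approximate state occupancy measures
(only the values of `density` on `params` matter). -/
structure RLGU (S A : Type*) [Fintype S] [Fintype A] (d m : ℕ) where
  /-- initial state distribution `ρ` -/
  init : PMF S
  /-- transition kernel `𝒫(· | s, a)` -/
  trans : S → A → PMF S
  /-- discount factor `γ` -/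
  disc : ℝ
  disc_pos : 0 < disc
  disc_lt_one : disc < 1
  /-- policies `π_θ(· | s)` -/
  policy : EuclideanSpace ℝ (Fin d) → S → PMF A
  /-- general utility `F` -/
  utility : EuclideanSpace ℝ (S × A) → ℝ
  /-- parameter set `Ω` -/
  params : Set (Fin m → ℝ)
  /-- densities `p_ω` -/
  density : (Fin m → ℝ) → PMF S

/-- The law of `n` independent samples from `q`. -/
def PMF.iid {α : Type*} (q : PMF α) : (n : ℕ) → PMF (Fin n → α)
  | 0 => PMF.pure Fin.elim0
  | n + 1 => q.bind fun x => (PMF.iid q n).map (Fin.cons (α := fun _ => α) x)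

/-- Expectation of a nonnegative random variable, with values in `[0, ∞]`. -/
def PMF.expect {α : Type*} (q : PMF α) (f : α → ℝ) : ENNReal :=
  ∑' x, q x * ENNReal.ofReal (f x)

namespace RLGU

variable {S A : Type*} [Fintype S] [Fintype A] {d m : ℕ}

/-- The law of `s_t` under `ℙ_{ρ, π_θ}`. -/
def stateLaw (P : RLGU S A d m) (θ : EuclideanSpace ℝ (Fin d)) : ℕ → PMF S
  | 0 => P.init
  | t + 1 => (P.stateLaw θ t).bind fun s => (P.policy θ s).bind fun a => P.trans s a

/-- The normalized state occupancy measure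
`d^{π_θ}(s) = (1 - γ) ∑_t γ^t ℙ_{ρ, π_θ}(s_t = s)`, a probability distribution on `S`. -/
def stateOcc (P : RLGU S A d m) (θ : EuclideanSpace ℝ (Fin d)) : PMF S :=
  ⟨fun s => ENNReal.ofReal (1 - P.disc) *
      ∑' t : ℕ, ENNReal.ofReal P.disc ^ t * P.stateLaw θ t s, by
    have h : ∑' s, ENNReal.ofReal (1 - P.disc) *
        ∑' t : ℕ, ENNReal.ofReal P.disc ^ t * P.stateLaw θ t s = 1 := by
      rw [ENNReal.tsum_mul_left, ENNReal.tsum_comm]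
      simp_rw [ENNReal.tsum_mul_left, PMF.tsum_coe, mul_one]
      rw [ENNReal.tsum_geometric, ENNReal.ofReal_sub _ P.disc_pos.le, ENNReal.ofReal_one]
      have h1 : ENNReal.ofReal P.disc < 1 := by
        rw [ENNReal.ofReal_lt_one]; exact P.disc_lt_one
      exact ENNReal.mul_inv_cancel (tsub_pos_of_lt h1).ne' (by simp)
    exact h ▸ ENNReal.summable.hasSum⟩

/-- The state-action measure `(s, a) ↦ q(s) π_θ(a | s)` as a vector of `ℝ^{S × A}`. -/
def withPolicy (P : RLGU S A d m) (q : PMF S) (θ : EuclideanSpace ℝ (Fin d)) :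
    EuclideanSpace ℝ (S × A) :=
  WithLp.toLp 2 fun x => (q x.1).toReal * (P.policy θ x.1 x.2).toReal

/-- The state-action occupancy measure `λ(θ) = λ^{π_θ}`. -/
def occ (P : RLGU S A d m) (θ : EuclideanSpace ℝ (Fin d)) : EuclideanSpace ℝ (S × A) :=
  P.withPolicy (P.stateOcc θ) θ

/-- The objective `θ ↦ F(λ^{π_θ})`. -/
def objective (P : RLGU S A d m) (θ : EuclideanSpace ℝ (Fin d)) : ℝ :=
  P.utility (P.occ θ)

/-- The score `∇_θ log π_θ(a | s)`. -/
def score (P : RLGU S A d m) (θ : EuclideanSpace ℝ (Fin d)) (s : S) (a : A) :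
    EuclideanSpace ℝ (Fin d) :=
  gradient (fun θ' => Real.log (P.policy θ' s a).toReal) θ

/-- The state-action measures `p_ω · π_θ` generated by the function class. -/
def measureClass (P : RLGU S A d m) : Set (EuclideanSpace ℝ (S × A)) :=
  {x | ∃ ω ∈ P.params, ∃ θ, x = P.withPolicy (P.density ω) θ}

/-- Regularity of the function approximation class; `‖·‖` on `Fin m → ℝ` is the sup norm. -/
structure ClassRegular (P : RLGU S A d m) (Bω BL : ℝ) : Prop where
  compact : IsCompact P.params
  bounded : ∀ ω ∈ P.params, ‖ω‖ ≤ Bω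
  realizable : ∀ θ, ∃ ω ∈ P.params, P.density ω = P.stateOcc θ
  lipschitz : ∃ L : S → ℝ, ∑ s, L s ≤ BL ∧
    ∀ s, ∀ ω ∈ P.params, ∀ ω' ∈ P.params,
      |(P.density ω s).toReal - (P.density ω' s).toReal| ≤ L s * ‖ω - ω'‖

/-- Regularity of the policy parametrization: positive, `C¹`, with bounded and Lipschitz score. -/
structure PolicyRegular (P : RLGU S A d m) (B Lπ : ℝ) : Prop where
  pos : ∀ θ s a, 0 < (P.policy θ s a).toReal
  contDiff : ∀ s a, ContDiff ℝ 1 fun θ => (P.policy θ s a).toReal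
  score_bounded : ∀ θ s a, ‖P.score θ s a‖ ≤ B
  score_lipschitz : ∀ θ θ' s a, ‖P.score θ s a - P.score θ' s a‖ ≤ Lπ * ‖θ - θ'‖

/-- Smoothness of the utility on the measures of the function class. -/
structure UtilitySmooth (P : RLGU S A d m) (lF LF : ℝ) : Prop where
  differentiable : ∀ x ∈ P.measureClass, DifferentiableAt ℝ P.utility x
  gradient_bounded : ∀ x ∈ P.measureClass, ‖gradient P.utility x‖ ≤ lF
  gradient_lipschitz : ∀ x ∈ P.measureClass, ∀ y ∈ P.measureClass,
    ‖gradient P.utility x - gradient P.utility y‖ ≤ LF * ‖x - y‖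

/-- The average log-likelihood `(1/n) ∑ log p_ω(s_i)`, with `log 0 = -∞`. -/
def logLik (P : RLGU S A d m) {n : ℕ} (D : Fin n → S) (ω : Fin m → ℝ) : EReal :=
  (((n : ℝ)⁻¹ : ℝ) : EReal) * ∑ i, ENNReal.log (P.density ω (D i))

/-- `ω` is a maximum likelihood estimate for the data set `D`. -/
def IsMLE (P : RLGU S A d m) {n : ℕ} (D : Fin n → S) (ω : Fin m → ℝ) : Prop :=
  ω ∈ P.params ∧ IsMaxOn (P.logLik D) P.params ω

/-- The law of a trajectory `(s_0, a_0, …, s_{H-1}, a_{H-1})` under `π_θ` started at `s_0 = s`. -/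
def trajFrom (P : RLGU S A d m) (θ : EuclideanSpace ℝ (Fin d)) :
    (H : ℕ) → S → PMF (Fin H → S × A)
  | 0, _ => PMF.pure Fin.elim0
  | H + 1, s => (P.policy θ s).bind fun a => (P.trans s a).bind fun s' =>
      (P.trajFrom θ H s').map (Fin.cons (α := fun _ => S × A) (s, a))

/-- The law of a trajectory of length `H` under `ℙ_{ρ, π_θ}`. -/
def traj (P : RLGU S A d m) (θ : EuclideanSpace ℝ (Fin d)) (H : ℕ) : PMF (Fin H → S × A) :=
  P.init.bind (P.trajFrom θ H)

/-- The truncated policy gradient estimate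
`g(τ, θ, r) = ∑_{t < H} (∑_{t ≤ h < H} γ^h r(s_h, a_h)) ∇ log π_θ(a_t | s_t)`. -/
def pgEstimate (P : RLGU S A d m) {H : ℕ} (τ : Fin H → S × A) (θ : EuclideanSpace ℝ (Fin d))
    (r : EuclideanSpace ℝ (S × A)) : EuclideanSpace ℝ (Fin d) :=
  ∑ t : Fin H, (∑ h ∈ Finset.Ici t, P.disc ^ (h : ℕ) * r (τ h)) • P.score θ (τ t).1 (τ t).2

/-- The parameter update: `θ + (α / N) ∑_i g(τ_i, θ, r̂)`, `r̂ = ∇F(λ̂)`, `λ̂ = p_ω · π_θ`. -/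
def update (P : RLGU S A d m) (α : ℝ) {N H : ℕ} (θ : EuclideanSpace ℝ (Fin d))
    (ω : Fin m → ℝ) (τ : Fin N → Fin H → S × A) : EuclideanSpace ℝ (Fin d) :=
  θ + (α / N) • ∑ i, P.pgEstimate (τ i) θ
    (gradient P.utility (P.withPolicy (P.density ω) θ))

/-- One iteration of the algorithm from `θ`: draw `n` i.i.d. states from `d^{π_θ}`, estimate the
occupancy measure with `est`, draw `N` independent trajectories of length `H`, update. -/
def step (P : RLGU S A d m) (α : ℝ) (N H : ℕ) {n : ℕ}
    (est : EuclideanSpace ℝ (Fin d) → (Fin n → S) → Fin m → ℝ)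
    (θ : EuclideanSpace ℝ (Fin d)) : PMF (EuclideanSpace ℝ (Fin d)) :=
  ((P.stateOcc θ).iid n).bind fun D => ((P.traj θ H).iid N).map fun τ =>
    P.update α θ (est θ D) τ

/-- The law of the iterate `θ_t`, started at `θ_0`; `est t` is the estimator used at time `t`. -/
def iterLaw (P : RLGU S A d m) (α : ℝ) (N H : ℕ) {n : ℕ}
    (est : ℕ → EuclideanSpace ℝ (Fin d) → (Fin n → S) → Fin m → ℝ)
    (θ₀ : EuclideanSpace ℝ (Fin d)) : ℕ → PMF (EuclideanSpace ℝ (Fin d))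
  | 0 => PMF.pure θ₀
  | t + 1 => (P.iterLaw α N H est θ₀ t).bind (P.step α N H (est t))

/-- The law of `θ_τ` with `τ` uniform on `{1, …, T}` and independent of the run. -/
def outputLaw (P : RLGU S A d m) (α : ℝ) (N H : ℕ) {n : ℕ}
    (est : ℕ → EuclideanSpace ℝ (Fin d) → (Fin n → S) → Fin m → ℝ)
    (θ₀ : EuclideanSpace ℝ (Fin d)) (T : ℕ) (hT : 1 ≤ T) : PMF (EuclideanSpace ℝ (Fin d)) :=
  (PMF.uniformOfFinset (Finset.Icc 1 T) (Finset.nonempty_Icc.2 hT)).bind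
    (P.iterLaw α N H est θ₀)

end RLGU

/-- The smoothness constant `L_θ` of the objective, in terms of the discount factor, the bound `B`
and Lipschitz constant `Lπ` of the score, and the constants `lF`, `LF` of the utility. -/
def smoothnessConst (γ B Lπ lF LF : ℝ) : ℝ :=
  LF * B ^ 2 / (1 - γ) ^ 4 + 2 * B ^ 2 * lF / (1 - γ) ^ 3 + lF * Lπ / (1 - γ) ^ 2

end

/-!
With `λ(θ)` the state-action occupancy measure, the objective `F(λ(θ))` has gradient
`∑ x, ∇F(λ(θ))(x) ∇λ(θ)(x)`. The transition kernel contracts total variation and `∇π = π ∇log π`,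
so `∑ x, ‖∇λ(θ)(x)‖ ≤ B / (1 - γ)`, and `∇λ` is Lipschitz in the same norm; hence the objective is
smooth with constant `(1 - γ) L_θ` (`RLGU.norm_objGrad_sub_le`), without reference to the number of
states or actions. As `λ` is normalized, `1 - γ` times the mean of the trajectory estimates
estimates the gradient, and the update is a gradient step of length `η = α / (1 - γ)`, for which
`η (1 - γ) L_θ = α L_θ ≤ 1 / 2`. Such a step `θ⁺`, with gradient estimate `g`, satisfies
`F(λ(θ⁺)) ≥ F(λ(θ)) + η / 2 (‖∇‖² - ‖g - ∇‖²)` (`RLGU.objective_add_smul_ge`), and telescoping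
reduces the theorem to a mean squared error of order `ε` for `g` (`RLGU.expect_outputLaw_le`).

This error has three parts (`RLGU.mean_mean_norm_gradEstimate_sub_sq_le`): a variance of order
`1 / N`, the truncation bias, which is exponentially small in `H` by the policy gradient theorem at
a finite horizon (`RLGU.mean_traj_pgEstimate`), and a multiple of the squared `ℓ¹` risk of the
maximum likelihood estimate of the state occupancy measure.

The risk is bounded in two ways. The parametric class is covered by about `n ^ (2 m)` brackets of
mass `O(n⁻²)`; a union bound over them for the square root of the likelihood ratio gives
`O(m log n / n)` in squared Hellinger distance, which dominates the squared `ℓ¹` distance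
(`RLGU.mean_mle_l1_sq_le`). In any class containing the truth, the estimate is at least as close to
the empirical distribution in Kullback–Leibler divergence as the truth is, and the expected
`χ²`-divergence of the empirical distribution from the truth is at most `|S| / n`
(`PMF.mean_iid_l1_sq_le_card`).
-/

/-! ### Finite expectations -/

namespace PMF

section Mean

variable {α β : Type*} [Fintype α] {E : Type*} [NormedAddCommGroup E] [InnerProductSpace ℝ E]

/-- The expectation of a vector-valued function under a distribution on a finite type, as a
finite sum; `PMF.expect` is its `[0, ∞]`-valued counterpart on arbitrary types. -/
noncomputable def mean (q : PMF α) (f : α → E) : E := ∑ x, (q x).toReal • f x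

lemma sum_toReal (q : PMF α) : ∑ x, (q x).toReal = 1 := by
  rw [← ENNReal.toReal_sum fun x _ => q.apply_ne_top x, ← tsum_fintype (L := .unconditional _),
    q.tsum_coe, ENNReal.toReal_one]

lemma toReal_bind (q : PMF α) (k : α → PMF β) (y : β) :
    (q.bind k y).toReal = ∑ x, (q x).toReal * (k x y).toReal := by
  rw [bind_apply, tsum_fintype, ENNReal.toReal_sum fun x _ =>
    ENNReal.mul_ne_top (q.apply_ne_top x) ((k x).apply_ne_top y)]
  simp

lemma mean_bind [Fintype β] (q : PMF α) (k : α → PMF β) (f : β → E) :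
    (q.bind k).mean f = q.mean fun x => (k x).mean f := by
  simp only [mean, toReal_bind, Finset.sum_smul, Finset.smul_sum, mul_smul]
  exact Finset.sum_comm

lemma mean_pure (x : α) (f : α → E) : (PMF.pure x).mean f = f x := by
  classical
  rw [mean, Finset.sum_eq_single x]
  · simp
  · intro y _ hy; simp [hy]
  · simp

lemma mean_map [Fintype β] (q : PMF α) (g : α → β) (f : β → E) :
    (q.map g).mean f = q.mean (f ∘ g) := by
  rw [map, mean_bind]
  simp [mean_pure, Function.comp_def]

lemma mean_const (q : PMF α) (c : E) : (q.mean fun _ => c) = c := by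
  rw [mean, ← Finset.sum_smul, sum_toReal, one_smul]

lemma mean_add (q : PMF α) (f g : α → E) :
    (q.mean fun x => f x + g x) = q.mean f + q.mean g := by
  simp [mean, smul_add, Finset.sum_add_distrib]

lemma mean_sub (q : PMF α) (f g : α → E) :
    (q.mean fun x => f x - g x) = q.mean f - q.mean g := by
  simp [mean, smul_sub, Finset.sum_sub_distrib]

lemma mean_smul (q : PMF α) (c : ℝ) (f : α → E) :
    (q.mean fun x => c • f x) = c • q.mean f := by
  simp only [mean, Finset.smul_sum]
  exact Finset.sum_congr rfl fun x _ => smul_comm _ _ _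

lemma mean_const_mul (q : PMF α) (c : ℝ) (f : α → ℝ) :
    (q.mean fun x => c * f x) = c * q.mean f := q.mean_smul c f

lemma mean_smul_const (q : PMF α) (f : α → ℝ) (v : E) :
    (q.mean fun x => f x • v) = q.mean f • v := by
  simp [mean, Finset.sum_smul, mul_smul]

lemma mean_sum {ι : Type*} (s : Finset ι) (q : PMF α) (f : ι → α → E) :
    (q.mean fun x => ∑ i ∈ s, f i x) = ∑ i ∈ s, q.mean (f i) := by
  simp only [mean, Finset.smul_sum]
  exact Finset.sum_comm

/-- Only the values on the support matter for the order of expectations. -/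
lemma mean_mono (q : PMF α) {f g : α → ℝ} (h : ∀ x, q x ≠ 0 → f x ≤ g x) :
    q.mean f ≤ q.mean g := by
  refine Finset.sum_le_sum fun x _ => ?_
  by_cases hx : q x = 0
  · simp [hx]
  · exact mul_le_mul_of_nonneg_left (h x hx) ENNReal.toReal_nonneg

lemma mean_nonneg (q : PMF α) {f : α → ℝ} (h : ∀ x, 0 ≤ f x) : 0 ≤ q.mean f :=
  Finset.sum_nonneg fun x _ => mul_nonneg ENNReal.toReal_nonneg (h x)

lemma mean_inner (q : PMF α) (f : α → E) (v : E) :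
    (q.mean fun x => inner ℝ (f x) v) = inner ℝ (q.mean f) v := by
  simp [mean, sum_inner, real_inner_smul_left]

lemma mean_norm_add_sq (q : PMF α) (f : α → E) (v : E) :
    (q.mean fun x => ‖f x + v‖ ^ 2) =
      (q.mean fun x => ‖f x‖ ^ 2) + 2 * inner ℝ (q.mean f) v + ‖v‖ ^ 2 := by
  simp only [norm_add_sq_real]
  rw [mean_add, mean_add, mean_const_mul, mean_inner, mean_const]

/-- The variance is at most the second moment. -/
lemma mean_norm_sub_mean_sq_le (q : PMF α) (f : α → E) :
    (q.mean fun x => ‖f x - q.mean f‖ ^ 2) ≤ q.mean fun x => ‖f x‖ ^ 2 := by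
  have h := q.mean_norm_add_sq f (-q.mean f)
  simp only [← sub_eq_add_neg, inner_neg_right, real_inner_self_eq_norm_sq, norm_neg] at h
  nlinarith [sq_nonneg ‖q.mean f‖]

lemma expect_eq_ofReal_mean (q : PMF α) {f : α → ℝ} (h : ∀ x, 0 ≤ f x) :
    q.expect f = ENNReal.ofReal (q.mean f) := by
  rw [expect, tsum_fintype, mean, ENNReal.ofReal_sum_of_nonneg fun x _ =>
    smul_nonneg ENNReal.toReal_nonneg (h x)]
  refine Finset.sum_congr rfl fun x _ => ?_
  rw [smul_eq_mul, ENNReal.ofReal_mul ENNReal.toReal_nonneg,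
    ENNReal.ofReal_toReal (q.apply_ne_top x)]

end Mean

section Expect

variable {α β : Type*}

lemma expect_bind (q : PMF α) (k : α → PMF β) (f : β → ℝ) :
    (q.bind k).expect f = ∑' x, q x * (k x).expect f := by
  simp only [expect, bind_apply, ← ENNReal.tsum_mul_right, ← ENNReal.tsum_mul_left, mul_assoc]
  exact ENNReal.tsum_comm

lemma expect_pure (x : α) (f : α → ℝ) : (PMF.pure x).expect f = ENNReal.ofReal (f x) := by
  classical
  rw [expect, tsum_eq_single x]
  · simp
  · intro y hy; simp [hy]

lemma expect_map (q : PMF α) (g : α → β) (f : β → ℝ) :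
    (q.map g).expect f = q.expect (f ∘ g) := by
  rw [map, expect_bind]
  simp [expect]

lemma expect_const_mul (q : PMF α) {c : ℝ} (hc : 0 ≤ c) (f : α → ℝ) :
    (q.expect fun x => c * f x) = ENNReal.ofReal c * q.expect f := by
  simp only [expect, ENNReal.ofReal_mul hc, ← ENNReal.tsum_mul_left]
  exact tsum_congr fun x => mul_left_comm _ _ _

end Expect

section Iid

/-- A sample of positive probability consists of points of positive probability. -/
lemma ne_zero_of_iid_ne_zero {α : Type*} (q : PMF α) {n : ℕ} {D : Fin n → α} (h : q.iid n D ≠ 0)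
    (i : Fin n) : q (D i) ≠ 0 := by
  induction n with
  | zero => exact i.elim0
  | succ n ih =>
    rw [iid, ← mem_support_iff, mem_support_bind_iff] at h
    obtain ⟨x, hx, hD⟩ := h
    rw [mem_support_map_iff] at hD
    obtain ⟨D', hD', rfl⟩ := hD
    refine Fin.cases ?_ (fun j => ?_) i
    · simpa using hx
    · simpa using ih hD' j

variable {α : Type*} [Fintype α] {E : Type*} [NormedAddCommGroup E] [InnerProductSpace ℝ E]

lemma mean_iid_succ (q : PMF α) (n : ℕ) (f : (Fin (n + 1) → α) → E) :
    (q.iid (n + 1)).mean f =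
      q.mean fun x => (q.iid n).mean fun D => f (Fin.cons (α := fun _ => α) x D) := by
  rw [iid, mean_bind]
  simp only [mean_map, Function.comp_def]

lemma mean_iid_prod (q : PMF α) (f : α → ℝ) (n : ℕ) :
    ((q.iid n).mean fun D => ∏ i, f (D i)) = q.mean f ^ n := by
  induction n with
  | zero => simp [iid, mean_pure]
  | succ n ih =>
    rw [mean_iid_succ]
    simp only [Fin.prod_univ_succ, Fin.cons_zero, Fin.cons_succ, mean_const_mul, ih]
    simp only [mul_comm (f _), mean_const_mul]
    rw [pow_succ]

lemma mean_iid_sum (q : PMF α) (f : α → E) (n : ℕ) :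
    ((q.iid n).mean fun D => ∑ i, f (D i)) = (n : ℝ) • q.mean f := by
  induction n with
  | zero => simp [iid, mean_pure]
  | succ n ih =>
    rw [mean_iid_succ]
    simp only [Fin.sum_univ_succ, Fin.cons_zero, Fin.cons_succ, mean_add, mean_const, ih]
    push_cast
    rw [add_smul, one_smul, add_comm]

/-- The variance of a sum of independent centred vectors is the sum of the variances. -/
lemma mean_iid_norm_sum_sq (q : PMF α) (f : α → E) (hf : q.mean f = 0) (n : ℕ) :
    ((q.iid n).mean fun D => ‖∑ i, f (D i)‖ ^ 2) = n * q.mean fun x => ‖f x‖ ^ 2 := by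
  induction n with
  | zero => simp [iid, mean_pure]
  | succ n ih =>
    rw [mean_iid_succ]
    simp only [Fin.sum_univ_succ, Fin.cons_zero, Fin.cons_succ]
    simp only [add_comm (f _), mean_norm_add_sq, mean_iid_sum, hf, smul_zero, inner_zero_left,
      mul_zero, add_zero, ih]
    rw [mean_add, mean_const]
    push_cast
    ring

/-- Mean squared error of an empirical average. -/
lemma mean_iid_norm_average_sub_sq_le (q : PMF α) (f : α → E) {n : ℕ} (hn : 0 < n) :
    ((q.iid n).mean fun D => ‖(n : ℝ)⁻¹ • ∑ i, f (D i) - q.mean f‖ ^ 2) ≤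
      (q.mean fun x => ‖f x - q.mean f‖ ^ 2) / n := by
  have hn' : (n : ℝ) ≠ 0 := by positivity
  have h := q.mean_iid_norm_sum_sq (fun x => f x - q.mean f)
    (by rw [mean_sub, mean_const, sub_self]) n
  have h2 : ∀ D : Fin n → α, ‖(n : ℝ)⁻¹ • ∑ i, f (D i) - q.mean f‖ ^ 2 =
      ((n : ℝ)⁻¹) ^ 2 * ‖∑ i, (f (D i) - q.mean f)‖ ^ 2 := by
    intro D
    rw [← mul_pow, ← abs_of_nonneg (by positivity : (0 : ℝ) ≤ (n : ℝ)⁻¹), ← Real.norm_eq_abs,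
      ← norm_smul, Finset.sum_sub_distrib, smul_sub]
    simp [← Nat.cast_smul_eq_nsmul ℝ, smul_smul, hn']
  simp only [h2, mean_const_mul, h]
  apply le_of_eq
  field_simp

end Iid

end PMF

/-! ### Maximum likelihood estimation -/

lemma sqrt_add_le_add_sqrt {x y : ℝ} (hx : 0 ≤ x) (hy : 0 ≤ y) : √(x + y) ≤ √x + √y := by
  rw [Real.sqrt_le_left (by positivity)]
  nlinarith [Real.sq_sqrt hx, Real.sq_sqrt hy, mul_nonneg (Real.sqrt_nonneg x) (Real.sqrt_nonneg y)]

lemma ENNReal.log_prod_eq_sum {ι : Type*} (s : Finset ι) (f : ι → ENNReal) :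
    ENNReal.log (∏ i ∈ s, f i) = ∑ i ∈ s, ENNReal.log (f i) := by
  classical
  induction s using Finset.induction with
  | empty => simp
  | insert i s hi ih => rw [Finset.prod_insert hi, Finset.sum_insert hi, ENNReal.log_mul_add, ih]

section Hellinger

variable {S : Type*} [Fintype S]

lemma sum_abs_sub_sq_le_hellinger {p q : S → ℝ} (hp : ∀ s, 0 ≤ p s) (hq : ∀ s, 0 ≤ q s)
    (hp1 : ∑ s, p s = 1) (hq1 : ∑ s, q s = 1) :
    (∑ s, |p s - q s|) ^ 2 ≤ 8 * (1 - ∑ s, √(p s) * √(q s)) := by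
  have h1 : ∑ s, (√(p s) - √(q s)) ^ 2 = 2 - 2 * ∑ s, √(p s) * √(q s) := by
    have : ∀ s, (√(p s) - √(q s)) ^ 2 = p s + q s - 2 * (√(p s) * √(q s)) := fun s => by
      nlinarith [Real.sq_sqrt (hp s), Real.sq_sqrt (hq s)]
    simp only [this, Finset.sum_sub_distrib, Finset.sum_add_distrib, hp1, hq1, ← Finset.mul_sum]
    norm_num
  have h2 : ∑ s, (√(p s) + √(q s)) ^ 2 = 2 + 2 * ∑ s, √(p s) * √(q s) := by
    have : ∀ s, (√(p s) + √(q s)) ^ 2 = p s + q s + 2 * (√(p s) * √(q s)) := fun s => by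
      nlinarith [Real.sq_sqrt (hp s), Real.sq_sqrt (hq s)]
    simp only [this, Finset.sum_add_distrib, hp1, hq1, ← Finset.mul_sum]
    norm_num
  have h3 : 0 ≤ 2 - 2 * ∑ s, √(p s) * √(q s) := h1 ▸ Finset.sum_nonneg fun s _ => sq_nonneg _
  have h4 : ∀ s, |p s - q s| = |√(p s) - √(q s)| * (√(p s) + √(q s)) := fun s => by
    rw [← abs_of_nonneg (by positivity : 0 ≤ √(p s) + √(q s)), ← abs_mul]
    congr 1
    nlinarith [Real.sq_sqrt (hp s), Real.sq_sqrt (hq s)]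
  have h5 := Finset.sum_mul_sq_le_sq_mul_sq Finset.univ (fun s => |√(p s) - √(q s)|)
    (fun s => √(p s) + √(q s))
  simp only [sq_abs, ← h4, h1, h2] at h5
  nlinarith

/-- A distribution `q` and a measure `u` dominating `p` with excess mass `η` have a Bhattacharyya
coefficient at most `√η` larger than that of `p` and `q`. -/
lemma sum_sqrt_mul_sqrt_le_of_le {p q u : S → ℝ} (hp : ∀ s, 0 ≤ p s) (hq : ∀ s, 0 ≤ q s)
    (hq1 : ∑ s, q s = 1) (hpu : ∀ s, p s ≤ u s) {η : ℝ} (hη : ∑ s, (u s - p s) ≤ η) :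
    ∑ s, √(u s) * √(q s) ≤ ∑ s, √(p s) * √(q s) + √η := by
  have h1 : ∀ s, √(u s) * √(q s) ≤ √(p s) * √(q s) + √(u s - p s) * √(q s) := fun s => by
    rw [← add_mul]
    refine mul_le_mul_of_nonneg_right ?_ (Real.sqrt_nonneg _)
    simpa using sqrt_add_le_add_sqrt (hp s) (sub_nonneg.2 (hpu s))
  refine (Finset.sum_le_sum fun s _ => h1 s).trans ?_
  rw [Finset.sum_add_distrib]
  gcongr
  apply Real.le_sqrt_of_sq_le
  have h5 := Finset.sum_mul_sq_le_sq_mul_sq Finset.univ (fun s => √(u s - p s)) (fun s => √(q s))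
  simp only [Real.sq_sqrt (hq _), Real.sq_sqrt (sub_nonneg.2 (hpu _)), hq1, mul_one] at h5
  exact h5.trans hη

end Hellinger

namespace PMF

/-- The empirical distribution of a sample. -/
noncomputable def empirical {S : Type*} {n : ℕ} (D : Fin n → S) (s : S) : ℝ := by
  classical exact (n : ℝ)⁻¹ * ∑ i, if D i = s then 1 else 0

lemma empirical_nonneg {S : Type*} {n : ℕ} (D : Fin n → S) (s : S) : 0 ≤ empirical D s := by
  unfold empirical; positivity

lemma exists_of_empirical_ne_zero {S : Type*} {n : ℕ} {D : Fin n → S} {s : S}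
    (h : empirical D s ≠ 0) :
    ∃ i, D i = s := by
  by_contra! hs
  exact h (by simp [empirical, hs])

variable {S : Type*} [Fintype S]

/-- Risk of a maximum likelihood estimate in a class covered by finitely many upper brackets
`u c`: the likelihood ratio with square roots, normalized by the `n`-th power of the
Bhattacharyya coefficient, has mean at most one for each bracket, and `log Z ≤ log K + Z / K - 1`
for their sum `Z` over `K` brackets. -/
lemma mean_iid_l1_sq_le_of_brackets {ι : Type*} [Fintype ι] (q : PMF S) {n : ℕ} (hn : 0 < n)
    (p : (Fin n → S) → PMF S)
    (hp : ∀ D, ∏ i, (q (D i)).toReal ≤ ∏ i, (p D (D i)).toReal)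
    (u : ι → S → ℝ) (hu : ∀ c s, 0 ≤ u c s) (c : (Fin n → S) → ι)
    (hc : ∀ D s, (p D s).toReal ≤ u (c D) s) {η : ℝ}
    (hη : ∀ D, ∑ s, (u (c D) s - (p D s).toReal) ≤ η) :
    ((q.iid n).mean fun D => (∑ s, |(p D s).toReal - (q s).toReal|) ^ 2) ≤
      8 * (Real.log (Fintype.card ι) / n + √η) := by
  have hn' : (0 : ℝ) < n := by exact_mod_cast hn
  set b : ι → ℝ := fun j => ∑ s, √(u j s) * √(q s).toReal with hb
  have hb0 : ∀ j, 0 ≤ b j := fun j => Finset.sum_nonneg fun s _ => by positivity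
  set W : ι → (Fin n → S) → ℝ := fun j D => (∏ i, √(u j (D i) / (q (D i)).toReal)) / b j ^ n
  have hW0 : ∀ j D, 0 ≤ W j D := fun j D =>
    div_nonneg (Finset.prod_nonneg fun i _ => Real.sqrt_nonneg _) (pow_nonneg (hb0 j) n)
  set Z : (Fin n → S) → ℝ := fun D => ∑ j, W j D with hZ
  have hWmean : ∀ j, (q.iid n).mean (W j) ≤ 1 := by
    intro j
    have h1 : (q.iid n).mean (W j) = b j ^ n / b j ^ n := by
      have h2 : q.mean (fun s => √(u j s / (q s).toReal)) = b j := by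
        refine Finset.sum_congr rfl fun s _ => ?_
        have hqs : (0 : ℝ) ≤ (q s).toReal := ENNReal.toReal_nonneg
        change (q s).toReal * √(u j s / (q s).toReal) = _
        rw [Real.sqrt_div' _ hqs]
        nth_rewrite 1 [← Real.mul_self_sqrt hqs]
        by_cases h0 : √(q s).toReal = 0
        · simp [h0]
        · field_simp
      have h3 := q.mean_iid_prod (fun s => √(u j s / (q s).toReal)) n
      rw [h2] at h3
      simp only [W, div_eq_inv_mul _ (b j ^ n), mean_const_mul, h3]
    rw [h1]
    exact div_self_le_one _
  have hι : (0 : ℝ) < Fintype.card ι := by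
    obtain ⟨s, -⟩ := q.support_nonempty
    exact_mod_cast Fintype.card_pos_iff.2 ⟨c fun _ => s⟩
  have hZmean : (q.iid n).mean Z ≤ Fintype.card ι := by
    rw [hZ, mean_sum]
    calc _ ≤ ∑ _j : ι, (1 : ℝ) := Finset.sum_le_sum fun j _ => hWmean j
      _ = _ := by simp
  have key : ∀ D, q.iid n D ≠ 0 → (∑ s, |(p D s).toReal - (q s).toReal|) ^ 2 ≤
      8 / n * (Real.log (Fintype.card ι) - 1 + Z D / Fintype.card ι) + 8 * √η := by
    intro D hD
    have hqD : ∀ i, 0 < (q (D i)).toReal := fun i =>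
      ENNReal.toReal_pos (q.ne_zero_of_iid_ne_zero hD i) (q.apply_ne_top _)
    have hpD : ∀ i, 0 < (p D (D i)).toReal := fun i =>
      lt_of_le_of_ne ENNReal.toReal_nonneg fun h =>
        absurd ((Finset.prod_pos fun i _ => hqD i).trans_le (hp D))
          (by rw [Finset.prod_eq_zero (Finset.mem_univ i) h.symm]; exact lt_irrefl _)
    have hbpos : 0 < b (c D) := by
      refine Finset.sum_pos' (fun s _ => by positivity) ⟨D ⟨0, hn⟩, Finset.mem_univ _, ?_⟩
      exact mul_pos (Real.sqrt_pos.2 ((hpD _).trans_le (hc D _))) (Real.sqrt_pos.2 (hqD _))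
    have h1 : 1 ≤ ∏ i, √(u (c D) (D i) / (q (D i)).toReal) := by
      rw [← Real.sqrt_prod _ fun i _ => div_nonneg (hu _ _) (hqD i).le, Real.one_le_sqrt,
        Finset.prod_div_distrib, one_le_div (Finset.prod_pos fun i _ => hqD i)]
      exact (hp D).trans (Finset.prod_le_prod (fun i _ => (hpD i).le) fun i _ => hc D _)
    have h2 : 1 ≤ Z D * b (c D) ^ n := by
      refine h1.trans ?_
      rw [← div_le_iff₀ (by positivity)]
      exact Finset.single_le_sum (f := fun j => W j D) (fun j _ => hW0 j D) (Finset.mem_univ (c D))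
    have hZpos : 0 < Z D := pos_of_mul_pos_left (one_pos.trans_le h2) (by positivity)
    have h3 : 0 ≤ Real.log (Z D) + n * Real.log (b (c D)) := by
      rw [← Real.log_pow, ← Real.log_mul hZpos.ne' (by positivity)]
      exact Real.log_nonneg h2
    have h4 : Real.log (Z D) ≤ Real.log (Fintype.card ι) + (Z D / Fintype.card ι - 1) := by
      have := Real.log_le_sub_one_of_pos (div_pos hZpos hι)
      rw [Real.log_div hZpos.ne' hι.ne'] at this
      linarith
    have h5 := Real.log_le_sub_one_of_pos hbpos
    have h6 := sum_sqrt_mul_sqrt_le_of_le (fun s => ENNReal.toReal_nonneg)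
      (fun s => ENNReal.toReal_nonneg) q.sum_toReal (hc D) (hη D)
    have h7 := sum_abs_sub_sq_le_hellinger (p := fun s => (p D s).toReal)
      (q := fun s => (q s).toReal) (fun s => ENNReal.toReal_nonneg)
      (fun s => ENNReal.toReal_nonneg) (p D).sum_toReal q.sum_toReal
    refine h7.trans ?_
    have h8 : n * (1 - ∑ s, √(p D s).toReal * √(q s).toReal) ≤
        (Real.log (Fintype.card ι) - 1 + Z D / Fintype.card ι) + n * √η := by
      have h9 := mul_le_mul_of_nonneg_left h5 hn'.le
      have h10 := mul_le_mul_of_nonneg_left h6 hn'.le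
      change (n : ℝ) * b (c D) ≤ _ at h10
      linarith
    have h11 := mul_le_mul_of_nonneg_left h8 (by positivity : (0 : ℝ) ≤ 8 / n)
    calc _ = 8 / n * (n * (1 - ∑ s, √(p D s).toReal * √(q s).toReal)) := by field_simp
      _ ≤ _ := h11
      _ = _ := by field_simp
  refine ((q.iid n).mean_mono key).trans ?_
  rw [mean_add, mean_const, mean_const_mul, mean_add, mean_const]
  simp only [div_eq_inv_mul _ (Fintype.card ι : ℝ), mean_const_mul]
  have h1 : (Fintype.card ι : ℝ)⁻¹ * (q.iid n).mean Z ≤ 1 := by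
    rw [inv_mul_le_iff₀ hι, mul_one]; exact hZmean
  have h2 := mul_le_mul_of_nonneg_left h1 (by positivity : (0 : ℝ) ≤ 8 / n)
  calc _ = 8 / n * (Real.log (Fintype.card ι) - 1)
        + 8 / n * ((Fintype.card ι : ℝ)⁻¹ * (q.iid n).mean Z) + 8 * √η := by ring
    _ ≤ 8 / n * (Real.log (Fintype.card ι) - 1) + 8 / n * 1 + 8 * √η := by linarith
    _ = _ := by field_simp; ring

lemma sum_empirical_mul {n : ℕ} (D : Fin n → S) (f : S → ℝ) :
    ∑ s, empirical D s * f s = (n : ℝ)⁻¹ * ∑ i, f (D i) := by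
  classical
  simp only [empirical, mul_assoc, ← Finset.mul_sum, Finset.sum_mul]
  rw [Finset.sum_comm]
  simp

lemma sum_empirical {n : ℕ} (hn : 0 < n) (D : Fin n → S) : ∑ s, empirical D s = 1 := by
  have h := sum_empirical_mul D fun _ => 1
  have : (n : ℝ) ≠ 0 := by positivity
  simpa [this] using h

/-- The expected `χ²`-divergence of the empirical distribution from the sampled one. -/
lemma mean_iid_chi_sq_le (q : PMF S) {n : ℕ} (hn : 0 < n) :
    ((q.iid n).mean fun D => ∑ s, (empirical D s - (q s).toReal) ^ 2 / (q s).toReal) ≤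
      Fintype.card S / n := by
  classical
  rw [mean_sum]
  have h : ∀ s, (q.iid n).mean (fun D => (empirical D s - (q s).toReal) ^ 2 / (q s).toReal) ≤
      1 / n := by
    intro s
    have hq : q.mean (fun x => if x = s then (1 : ℝ) else 0) = (q s).toReal := by simp [mean]
    have hq2 : q.mean (fun x => ‖if x = s then (1 : ℝ) else 0‖ ^ 2) = (q s).toReal := by
      rw [← hq]; congr 1; ext x; split_ifs <;> simp
    have h1 := q.mean_iid_norm_average_sub_sq_le (fun x => if x = s then (1 : ℝ) else 0) hn
    have h2 := q.mean_norm_sub_mean_sq_le (fun x => if x = s then (1 : ℝ) else 0)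
    rw [hq2] at h2
    have h3 : (q.iid n).mean (fun D => (empirical D s - (q s).toReal) ^ 2) ≤ (q s).toReal / n := by
      refine le_trans (le_of_eq ?_) (h1.trans (div_le_div_of_nonneg_right h2 (by positivity)))
      simp [hq, empirical]
    simp only [div_eq_inv_mul _ (q s).toReal, mean_const_mul]
    refine (mul_le_mul_of_nonneg_left h3 (by positivity)).trans ?_
    rw [← mul_div_assoc]
    exact div_le_div_of_nonneg_right (inv_mul_le_one) (by positivity)
  refine (Finset.sum_le_sum fun s _ => h s).trans (le_of_eq ?_)
  simp [div_eq_mul_inv]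

/-- The Kullback–Leibler divergence dominates the squared Hellinger distance. -/
lemma two_mul_one_sub_le_sum_mul_log {p q : S → ℝ} (hp : ∀ s, 0 ≤ p s) (hq : ∀ s, 0 ≤ q s)
    (hp1 : ∑ s, p s = 1) (hpq : ∀ s, p s ≠ 0 → q s ≠ 0) :
    2 * (1 - ∑ s, √(p s) * √(q s)) ≤ ∑ s, p s * (Real.log (p s) - Real.log (q s)) := by
  have h : ∀ s, 2 * (p s - √(p s) * √(q s)) ≤ p s * (Real.log (p s) - Real.log (q s)) := by
    intro s
    by_cases h0 : p s = 0
    · simp [h0]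
    have hps := lt_of_le_of_ne (hp s) (Ne.symm h0)
    have hqs := lt_of_le_of_ne (hq s) (hpq s h0).symm
    have h1 := Real.log_le_sub_one_of_pos (div_pos (Real.sqrt_pos.2 hqs) (Real.sqrt_pos.2 hps))
    rw [Real.log_div (by positivity) (by positivity), Real.log_sqrt hqs.le,
      Real.log_sqrt hps.le] at h1
    have h2 : p s * (√(q s) / √(p s)) = √(p s) * √(q s) := by
      nth_rewrite 1 [← Real.mul_self_sqrt hps.le]
      field_simp
    nlinarith [mul_le_mul_of_nonneg_left h1 hps.le]
  calc _ = ∑ s, 2 * (p s - √(p s) * √(q s)) := by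
        rw [← Finset.mul_sum, Finset.sum_sub_distrib, hp1]
    _ ≤ _ := Finset.sum_le_sum fun s _ => h s

/-- The Kullback–Leibler divergence is at most the `χ²`-divergence. -/
lemma sum_mul_log_le_chi_sq {p q : S → ℝ} (hp : ∀ s, 0 ≤ p s) (hq : ∀ s, 0 ≤ q s)
    (hp1 : ∑ s, p s = 1) (hq1 : ∑ s, q s = 1) (hpq : ∀ s, p s ≠ 0 → q s ≠ 0) :
    ∑ s, p s * (Real.log (p s) - Real.log (q s)) ≤ ∑ s, (p s - q s) ^ 2 / q s := by
  have h : ∀ s, p s * (Real.log (p s) - Real.log (q s)) ≤ (p s - q s) ^ 2 / q s + (p s - q s) := by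
    intro s
    by_cases h0 : q s = 0
    · have : p s = 0 := by by_contra h1; exact hpq s h1 h0
      simp [h0, this]
    have hqs := lt_of_le_of_ne (hq s) (Ne.symm h0)
    have h3 : (p s - q s) ^ 2 / q s + (p s - q s) = p s * (p s / q s - 1) := by field_simp; ring
    rw [h3]
    by_cases h1 : p s = 0
    · simp [h1]
    have hps := lt_of_le_of_ne (hp s) (Ne.symm h1)
    rw [← Real.log_div h1 h0]
    exact mul_le_mul_of_nonneg_left (Real.log_le_sub_one_of_pos (div_pos hps hqs)) hps.le
  refine (Finset.sum_le_sum fun s _ => h s).trans (le_of_eq ?_)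
  rw [Finset.sum_add_distrib, Finset.sum_sub_distrib, hp1, hq1]
  ring

/-- Risk of a maximum likelihood estimate in an arbitrary class: the estimate is at least as close
to the empirical distribution, in Kullback–Leibler divergence, as the truth is. -/
lemma mean_iid_l1_sq_le_card (q : PMF S) {n : ℕ} (hn : 0 < n) (p : (Fin n → S) → PMF S)
    (hp : ∀ D, ∏ i, (q (D i)).toReal ≤ ∏ i, (p D (D i)).toReal) :
    ((q.iid n).mean fun D => (∑ s, |(p D s).toReal - (q s).toReal|) ^ 2) ≤
      16 * (Fintype.card S / n) := by
  refine le_trans ((q.iid n).mean_mono fun D hD => ?_)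
    (((q.iid n).mean_const_mul 16 _).le.trans
      (mul_le_mul_of_nonneg_left (q.mean_iid_chi_sq_le hn) (by norm_num)))
  have hqD : ∀ i, 0 < (q (D i)).toReal := fun i =>
    ENNReal.toReal_pos (q.ne_zero_of_iid_ne_zero hD i) (q.apply_ne_top _)
  have hpD : ∀ i, 0 < (p D (D i)).toReal := fun i =>
    lt_of_le_of_ne ENNReal.toReal_nonneg fun h =>
      absurd ((Finset.prod_pos fun i _ => hqD i).trans_le (hp D))
        (by rw [Finset.prod_eq_zero (Finset.mem_univ i) h.symm]; exact lt_irrefl _)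
  have hEq : ∀ s, empirical D s ≠ 0 → (q s).toReal ≠ 0 := fun s hs => by
    obtain ⟨i, rfl⟩ := exists_of_empirical_ne_zero hs; exact (hqD i).ne'
  have hEp : ∀ s, empirical D s ≠ 0 → (p D s).toReal ≠ 0 := fun s hs => by
    obtain ⟨i, rfl⟩ := exists_of_empirical_ne_zero hs; exact (hpD i).ne'
  have hE0 := empirical_nonneg D
  have hE1 := sum_empirical hn D
  have hq0 : ∀ s, 0 ≤ (q s).toReal := fun s => ENNReal.toReal_nonneg
  have hp0 : ∀ s, 0 ≤ (p D s).toReal := fun s => ENNReal.toReal_nonneg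
  have hKL := sum_mul_log_le_chi_sq hE0 hq0 hE1 q.sum_toReal hEq
  have hlik : ∑ s, empirical D s * Real.log (q s).toReal ≤
      ∑ s, empirical D s * Real.log (p D s).toReal := by
    rw [sum_empirical_mul, sum_empirical_mul]
    refine mul_le_mul_of_nonneg_left ?_ (by positivity)
    rw [← Real.log_prod fun i _ => (hqD i).ne', ← Real.log_prod fun i _ => (hpD i).ne']
    exact Real.log_le_log (Finset.prod_pos fun i _ => hqD i) (hp D)
  have h1 := two_mul_one_sub_le_sum_mul_log hE0 hq0 hE1 hEq
  have h2 := two_mul_one_sub_le_sum_mul_log hE0 hp0 hE1 hEp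
  have h3 := sum_abs_sub_sq_le_hellinger hE0 hq0 hE1 q.sum_toReal
  have h4 := sum_abs_sub_sq_le_hellinger hE0 hp0 hE1 (p D).sum_toReal
  have h5 : ∑ s, |(p D s).toReal - (q s).toReal| ≤
      ∑ s, |empirical D s - (p D s).toReal| + ∑ s, |empirical D s - (q s).toReal| := by
    rw [← Finset.sum_add_distrib]
    refine Finset.sum_le_sum fun s _ => ?_
    rw [abs_sub_comm (empirical D s)]
    exact abs_sub_le _ _ _
  simp only [mul_sub, Finset.sum_sub_distrib] at h1 h2 hKL
  have h6 : (0 : ℝ) ≤ ∑ s, |(p D s).toReal - (q s).toReal| :=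
    Finset.sum_nonneg fun s _ => abs_nonneg _
  have h7 := pow_le_pow_left₀ h6 h5 2
  nlinarith [sq_nonneg (∑ s, |empirical D s - (p D s).toReal|
    - ∑ s, |empirical D s - (q s).toReal|)]

end PMF

namespace RLGU

variable {S A : Type*} [Fintype S] [Fintype A] {d m : ℕ}

lemma IsMLE.prod_le {P : RLGU S A d m} {n : ℕ} (hn : 0 < n) {D : Fin n → S} {ω ω' : Fin m → ℝ}
    (h : P.IsMLE D ω) (hω' : ω' ∈ P.params) :
    ∏ i, (P.density ω' (D i)).toReal ≤ ∏ i, (P.density ω (D i)).toReal := by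
  have h1 : P.logLik D ω' ≤ P.logLik D ω := h.2 hω'
  simp only [logLik, ← ENNReal.log_prod_eq_sum] at h1
  have h2 := mul_le_mul_of_nonneg_left h1 (EReal.coe_nonneg.2 (Nat.cast_nonneg (α := ℝ) n))
  have hn' : (n : ℝ) ≠ 0 := by positivity
  rw [← mul_assoc, ← mul_assoc, ← EReal.coe_mul, mul_inv_cancel₀ hn', EReal.coe_one, one_mul,
    one_mul, ENNReal.log_le_log_iff] at h2
  rw [← ENNReal.toReal_prod, ← ENNReal.toReal_prod]
  exact ENNReal.toReal_mono (ENNReal.prod_ne_top fun i _ => PMF.apply_ne_top _ _) h2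

/-- The Lipschitz weights may be taken nonnegative. -/
lemma ClassRegular.exists_lipschitz {P : RLGU S A d m} {Bω BL : ℝ} (h : P.ClassRegular Bω BL)
    (hBL : 0 ≤ BL) : ∃ L : S → ℝ, (∀ s, 0 ≤ L s) ∧ ∑ s, L s ≤ BL ∧
      ∀ s, ∀ ω ∈ P.params, ∀ ω' ∈ P.params,
        |(P.density ω s).toReal - (P.density ω' s).toReal| ≤ L s * ‖ω - ω'‖ := by
  by_cases hs : P.params.Subsingleton
  · refine ⟨0, fun _ => le_rfl, by simpa using hBL, fun s ω hω ω' hω' => ?_⟩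
    simp [hs hω hω']
  · obtain ⟨L, hL, hlip⟩ := h.lipschitz
    refine ⟨L, fun s => ?_, hL, hlip⟩
    obtain ⟨ω, hω, ω', hω', hne⟩ := Set.not_subsingleton_iff.1 hs
    exact nonneg_of_mul_nonneg_left ((abs_nonneg _).trans (hlip s ω hω ω' hω'))
      (norm_pos_iff.2 (sub_ne_zero.2 hne))

/-- Risk of the maximum likelihood estimate in a Lipschitz class, by brackets centred at one point
of the parameter set in each cell of a grid of mesh `n⁻²`; at this mesh the excess mass of a bracket
is of order `n⁻²`, and its square root costs no more than `1 / n`. -/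
lemma mean_mle_l1_sq_le {P : RLGU S A d m} {Bω BL : ℝ} (h : P.ClassRegular Bω BL)
    (hBω : 0 ≤ Bω) (hBL : 0 ≤ BL) {n : ℕ} (hn : 0 < n) (est : (Fin n → S) → Fin m → ℝ)
    (hest : ∀ D, P.IsMLE D (est D)) {ω₀ : Fin m → ℝ} (hω₀ : ω₀ ∈ P.params) :
    (((P.density ω₀).iid n).mean fun D =>
      (∑ s, |(P.density (est D) s).toReal - (P.density ω₀ s).toReal|) ^ 2) ≤
      8 * (m * Real.log (2 * Bω * n ^ 2 + 1) / n + √(2 * BL) / n) := by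
  classical
  obtain ⟨L, hL0, hL, hlip⟩ := h.exists_lipschitz hBL
  have hn' : (0 : ℝ) < n := by exact_mod_cast hn
  set M : ℕ := ⌊2 * Bω * n ^ 2⌋₊ + 1 with hM
  have hcoord : ∀ ω ∈ P.params, ∀ i, 0 ≤ ω i + Bω ∧ ω i + Bω ≤ 2 * Bω := fun ω hω i => by
    have h1 := (norm_le_pi_norm ω i).trans (h.bounded ω hω)
    rw [Real.norm_eq_abs, abs_le] at h1
    constructor <;> linarith
  -- the grid cell of a parameter; the `min` is inactive on the parameter set
  set cell : (Fin m → ℝ) → Fin m → Fin M := fun ω i =>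
    ⟨min ⌊(ω i + Bω) * n ^ 2⌋₊ ⌊2 * Bω * n ^ 2⌋₊, by rw [hM]; omega⟩ with hcell
  have hclose : ∀ ω ∈ P.params, ∀ ω' ∈ P.params, cell ω = cell ω' →
      ‖ω - ω'‖ ≤ ((n : ℝ) ^ 2)⁻¹ := by
    intro ω hω ω' hω' hc
    rw [pi_norm_le_iff_of_nonneg (by positivity)]
    intro i
    have h1 := hcoord ω hω i
    have h2 := hcoord ω' hω' i
    have h3 := congrArg Fin.val (congrFun hc i)
    simp only [hcell] at h3
    rw [min_eq_left (Nat.floor_le_floor (by gcongr; exact h1.2)),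
      min_eq_left (Nat.floor_le_floor (by gcongr; exact h2.2))] at h3
    have h4 := Nat.floor_le (mul_nonneg h1.1 (sq_nonneg (n : ℝ)))
    have h5 := Nat.floor_le (mul_nonneg h2.1 (sq_nonneg (n : ℝ)))
    have h6 := Nat.lt_floor_add_one ((ω i + Bω) * (n : ℝ) ^ 2)
    have h7 := Nat.lt_floor_add_one ((ω' i + Bω) * (n : ℝ) ^ 2)
    rw [h3] at h4 h6
    rw [Pi.sub_apply, Real.norm_eq_abs, ← one_div, le_div_iff₀ (by positivity),
      ← abs_of_pos (by positivity : (0 : ℝ) < (n : ℝ) ^ 2), ← abs_mul, abs_le]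
    constructor <;> linarith
  -- a parameter in each cell that meets the parameter set
  have hrep : ∀ k : Fin m → Fin M, ∃ ω, (∃ ω' ∈ P.params, cell ω' = k) →
      ω ∈ P.params ∧ cell ω = k := fun k => by
    by_cases hk : ∃ ω' ∈ P.params, cell ω' = k
    · obtain ⟨ω', h1, h2⟩ := hk
      exact ⟨ω', fun _ => ⟨h1, h2⟩⟩
    · exact ⟨0, fun h => absurd h hk⟩
  choose rep hrep using hrep
  have hdist : ∀ D s, |(P.density (rep (cell (est D))) s).toReal - (P.density (est D) s).toReal| ≤
      L s * ((n : ℝ) ^ 2)⁻¹ := fun D s => by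
    obtain ⟨h1, h2⟩ := hrep (cell (est D)) ⟨est D, (hest D).1, rfl⟩
    exact (hlip s _ h1 _ (hest D).1).trans
      (mul_le_mul_of_nonneg_left (hclose _ h1 _ (hest D).1 h2) (hL0 s))
  have key := (P.density ω₀).mean_iid_l1_sq_le_of_brackets hn (fun D => P.density (est D))
    (fun D => (hest D).prod_le hn hω₀)
    (fun k s => (P.density (rep k) s).toReal + L s * ((n : ℝ) ^ 2)⁻¹)
    (fun k s => add_nonneg ENNReal.toReal_nonneg (mul_nonneg (hL0 s) (by positivity)))
    (fun D => cell (est D)) (fun D s => by linarith [(abs_le.1 (hdist D s)).1])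
    (η := 2 * BL * ((n : ℝ) ^ 2)⁻¹) (fun D => by
      calc _ ≤ ∑ s, 2 * (L s * ((n : ℝ) ^ 2)⁻¹) :=
            Finset.sum_le_sum fun s _ => by linarith [(abs_le.1 (hdist D s)).2]
        _ = 2 * (∑ s, L s) * ((n : ℝ) ^ 2)⁻¹ := by
            rw [← Finset.mul_sum, ← Finset.sum_mul, mul_assoc]
        _ ≤ _ := by gcongr)
  refine key.trans ?_
  rw [Real.sqrt_mul (by positivity), Real.sqrt_inv, Real.sqrt_sq hn'.le, ← div_eq_mul_inv]
  gcongr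
  rw [Fintype.card_fun, Fintype.card_fin, Fintype.card_fin, Nat.cast_pow, Real.log_pow]
  gcongr
  rw [hM]
  push_cast
  gcongr
  exact Nat.floor_le (by positivity)

end RLGU

/-! ### Discounted sums -/

lemma hasSum_pow_mul_add_one {γ : ℝ} (h0 : 0 < γ) (h1 : γ < 1) :
    HasSum (fun t : ℕ => γ ^ t * ((t : ℝ) + 1)) (1 / (1 - γ) ^ 2) := by
  have h := hasSum_choose_mul_geometric_of_norm_lt_one 1 (r := γ)
    (by rwa [Real.norm_eq_abs, abs_of_pos h0])
  simpa [mul_comm] using h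

lemma hasSum_pow_mul_add_two_mul_add_one {γ : ℝ} (h0 : 0 < γ) (h1 : γ < 1) :
    HasSum (fun t : ℕ => γ ^ t * (((t : ℝ) + 2) * (t + 1))) (2 / (1 - γ) ^ 3) := by
  have h := (hasSum_choose_mul_geometric_of_norm_lt_one 2 (r := γ)
    (by rwa [Real.norm_eq_abs, abs_of_pos h0])).mul_left 2
  have h2 : (fun t : ℕ => γ ^ t * (((t : ℝ) + 2) * (t + 1))) =
      fun t : ℕ => 2 * (((t + 2).choose 2 : ℝ) * γ ^ t) := by
    ext t
    rw [Nat.cast_choose_two]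
    push_cast
    ring
  rw [h2, show 2 / (1 - γ) ^ 3 = 2 * (1 / (1 - γ) ^ (2 + 1)) by norm_num; ring]
  exact h

section Discounted

lemma summable_discounted {X E : Type*} [Fintype X] [NormedAddCommGroup E] {γ : ℝ}
    (h0 : 0 < γ) {v : ℕ → X → E} {c : ℕ → ℝ}
    (hv : ∀ t, ∑ x, ‖v t x‖ ≤ c t) (hc : Summable fun t => γ ^ t * c t) (x : X) :
    Summable fun t => γ ^ t * ‖v t x‖ := by
  refine Summable.of_nonneg_of_le (fun t => by positivity) (fun t => ?_) hc
  exact mul_le_mul_of_nonneg_left ((Finset.single_le_sum (f := fun x => ‖v t x‖)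
    (fun x _ => norm_nonneg _) (Finset.mem_univ x)).trans (hv t)) (by positivity)

variable {X E : Type*} [Fintype X] [NormedAddCommGroup E] [NormedSpace ℝ E]

lemma summable_smul_discounted [CompleteSpace E] {γ : ℝ} (h0 : 0 < γ) {v : ℕ → X → E} {c : ℕ → ℝ}
    (hv : ∀ t, ∑ x, ‖v t x‖ ≤ c t) (hc : Summable fun t => γ ^ t * c t) (x : X) :
    Summable fun t => γ ^ t • v t x := by
  refine Summable.of_norm ?_
  simpa [norm_smul, abs_of_pos h0] using summable_discounted h0 hv hc x

lemma sum_norm_tsum_le {γ : ℝ} (h0 : 0 < γ) {v : ℕ → X → E} {c : ℕ → ℝ} {K : ℝ}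
    (hv : ∀ t, ∑ x, ‖v t x‖ ≤ c t) (hc : HasSum (fun t => γ ^ t * c t) K) :
    ∑ x, ‖∑' t, γ ^ t • v t x‖ ≤ K := by
  have h1 := fun x => summable_discounted h0 hv hc.summable x
  calc ∑ x, ‖∑' t, γ ^ t • v t x‖ ≤ ∑ x, ∑' t, γ ^ t * ‖v t x‖ := by
        refine Finset.sum_le_sum fun x _ => ?_
        have h2 := norm_tsum_le_tsum_norm (f := fun t => γ ^ t • v t x)
          (by simpa [norm_smul, abs_of_pos h0] using h1 x)
        simpa [norm_smul, abs_of_pos h0] using h2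
    _ = ∑' t, γ ^ t * ∑ x, ‖v t x‖ := by
        rw [← Summable.tsum_finsetSum fun x _ => h1 x]
        simp only [Finset.mul_sum]
    _ ≤ ∑' t, γ ^ t * c t := by
        have h3 : ∀ t, γ ^ t * ∑ x, ‖v t x‖ ≤ γ ^ t * c t := fun t =>
          mul_le_mul_of_nonneg_left (hv t) (by positivity)
        exact Summable.tsum_le_tsum h3 (Summable.of_nonneg_of_le (fun t => by positivity) h3
          hc.summable) hc.summable
    _ = K := hc.tsum_eq

end Discounted

/-! ### Sums of vectors -/

lemma norm_sum_smul_le {X E : Type*} [Fintype X] [SeminormedAddCommGroup E] [NormedSpace ℝ E]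
    {r : X → ℝ} {v : X → E} {c C : ℝ} (hr : ∀ x, |r x| ≤ c) (hc : 0 ≤ c) (hv : ∑ x, ‖v x‖ ≤ C) :
    ‖∑ x, r x • v x‖ ≤ c * C := by
  calc _ ≤ ∑ x, c * ‖v x‖ := by
        refine (norm_sum_le _ _).trans (Finset.sum_le_sum fun x _ => ?_)
        rw [norm_smul]
        exact mul_le_mul_of_nonneg_right (hr x) (norm_nonneg _)
    _ ≤ _ := by rw [← Finset.mul_sum]; exact mul_le_mul_of_nonneg_left hv hc

lemma norm_le_sum_abs {X : Type*} [Fintype X] (v : EuclideanSpace ℝ X) : ‖v‖ ≤ ∑ x, |v x| := by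
  rw [EuclideanSpace.norm_eq, Real.sqrt_le_left (Finset.sum_nonneg fun _ _ => abs_nonneg _)]
  exact Finset.sum_sq_le_sq_sum_of_nonneg fun _ _ => abs_nonneg _

lemma abs_apply_le_norm {X : Type*} [Fintype X] (v : EuclideanSpace ℝ X) (x : X) : |v x| ≤ ‖v‖ :=
  PiLp.norm_apply_le v x

/-! ### Derivatives of the occupancy measures -/

namespace RLGU

variable {S A : Type*} [Fintype S] [Fintype A] {d m : ℕ}

/-- The probability `ℙ_{ρ, π_θ}(s_t = s)` as a real number. -/
noncomputable def stateProb (P : RLGU S A d m) (θ : EuclideanSpace ℝ (Fin d)) (t : ℕ) (s : S) : ℝ :=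
  (P.stateLaw θ t s).toReal

/-- The probability `π_θ(a | s)` as a real number, for `x = (s, a)`. -/
noncomputable def actProb (P : RLGU S A d m) (θ : EuclideanSpace ℝ (Fin d)) (x : S × A) : ℝ :=
  (P.policy θ x.1 x.2).toReal

/-- The transition probability `𝒫(s' | s, a)` as a real number, for `x = (s, a)`. -/
noncomputable def transProb (P : RLGU S A d m) (x : S × A) (s' : S) : ℝ :=
  (P.trans x.1 x.2 s').toReal

/-- The probability `ℙ_{ρ, π_θ}(s_t = s, a_t = a)`, for `x = (s, a)`. -/
noncomputable def pairProb (P : RLGU S A d m) (θ : EuclideanSpace ℝ (Fin d)) (t : ℕ)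
    (x : S × A) : ℝ :=
  P.stateProb θ t x.1 * P.actProb θ x

/-- The gradient in `θ` of `ℙ_{ρ, π_θ}(s_t = s)`, by forward recursion in `t`. -/
noncomputable def stateGrad (P : RLGU S A d m) (θ : EuclideanSpace ℝ (Fin d)) :
    ℕ → S → EuclideanSpace ℝ (Fin d)
  | 0, _ => 0
  | t + 1, s' => ∑ x : S × A, P.transProb x s' •
      (P.actProb θ x • P.stateGrad θ t x.1 + P.pairProb θ t x • P.score θ x.1 x.2)

/-- The gradient in `θ` of `ℙ_{ρ, π_θ}(s_t = s, a_t = a)`, for `x = (s, a)`. -/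
noncomputable def pairGrad (P : RLGU S A d m) (θ : EuclideanSpace ℝ (Fin d)) (t : ℕ)
    (x : S × A) : EuclideanSpace ℝ (Fin d) :=
  P.actProb θ x • P.stateGrad θ t x.1 + P.pairProb θ t x • P.score θ x.1 x.2

section Basic

variable (P : RLGU S A d m) (θ : EuclideanSpace ℝ (Fin d))

lemma stateProb_nonneg (t : ℕ) (s : S) : 0 ≤ P.stateProb θ t s := ENNReal.toReal_nonneg

lemma actProb_nonneg (x : S × A) : 0 ≤ P.actProb θ x := ENNReal.toReal_nonneg

lemma transProb_nonneg (x : S × A) (s' : S) : 0 ≤ P.transProb x s' := ENNReal.toReal_nonneg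

lemma pairProb_nonneg (t : ℕ) (x : S × A) : 0 ≤ P.pairProb θ t x :=
  mul_nonneg (P.stateProb_nonneg θ t _) (P.actProb_nonneg θ x)

lemma sum_stateProb (t : ℕ) : ∑ s, P.stateProb θ t s = 1 := PMF.sum_toReal _

lemma sum_transProb (x : S × A) : ∑ s', P.transProb x s' = 1 := PMF.sum_toReal _

lemma sum_actProb (s : S) : ∑ a, P.actProb θ (s, a) = 1 :=
  (P.policy θ s).sum_toReal

lemma sum_actProb_mul (f : S → ℝ) : ∑ x : S × A, P.actProb θ x * f x.1 = ∑ s, f s := by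
  rw [Fintype.sum_prod_type]
  simp only [← Finset.sum_mul, sum_actProb, one_mul]

lemma sum_pairProb (t : ℕ) : ∑ x, P.pairProb θ t x = 1 := by
  simp only [pairProb, mul_comm (P.stateProb θ t _)]
  rw [P.sum_actProb_mul θ (P.stateProb θ t), sum_stateProb]

lemma stateProb_succ (t : ℕ) (s' : S) :
    P.stateProb θ (t + 1) s' = ∑ x, P.transProb x s' * P.pairProb θ t x := by
  rw [stateProb, stateLaw, PMF.toReal_bind, Fintype.sum_prod_type]
  refine Finset.sum_congr rfl fun s _ => ?_
  rw [PMF.toReal_bind, Finset.mul_sum]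
  refine Finset.sum_congr rfl fun a _ => ?_
  simp only [transProb, pairProb, stateProb, actProb]
  ring

lemma stateGrad_succ (t : ℕ) (s' : S) :
    P.stateGrad θ (t + 1) s' = ∑ x, P.transProb x s' • P.pairGrad θ t x := rfl

/-- The transition kernel is a contraction in total variation. -/
lemma sum_norm_transport_le {E : Type*} [NormedAddCommGroup E] [NormedSpace ℝ E]
    (v : S × A → E) : ∑ s', ‖∑ x, P.transProb x s' • v x‖ ≤ ∑ x, ‖v x‖ := by
  calc _ ≤ ∑ s', ∑ x, P.transProb x s' * ‖v x‖ := by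
        refine Finset.sum_le_sum fun s' _ => (norm_sum_le _ _).trans_eq ?_
        simp only [norm_smul, Real.norm_eq_abs, abs_of_nonneg (P.transProb_nonneg _ _)]
    _ = _ := by
        rw [Finset.sum_comm]
        simp only [← Finset.sum_mul, sum_transProb, one_mul]

lemma occ_apply (x : S × A) :
    P.occ θ x = (1 - P.disc) * ∑' t : ℕ, P.disc ^ t * P.pairProb θ t x := by
  have h1 : ((P.stateOcc θ) x.1).toReal =
      (1 - P.disc) * ∑' t, P.disc ^ t * P.stateProb θ t x.1 := by
    change (ENNReal.ofReal (1 - P.disc) *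
      ∑' t : ℕ, ENNReal.ofReal P.disc ^ t * P.stateLaw θ t x.1).toReal = _
    rw [ENNReal.toReal_mul, ENNReal.toReal_ofReal (by linarith [P.disc_lt_one]),
      ENNReal.tsum_toReal_eq fun t => ENNReal.mul_ne_top (by finiteness)
        ((P.stateLaw θ t).apply_ne_top _)]
    simp only [ENNReal.toReal_mul, ENNReal.toReal_pow, ENNReal.toReal_ofReal P.disc_pos.le,
      stateProb]
  change ((P.stateOcc θ) x.1).toReal * P.actProb θ x = _
  simp only [h1, pairProb, ← mul_assoc, tsum_mul_right]

end Basic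

/-- The gradient in `θ` of the state-action occupancy measure `λ(θ)` at `x = (s, a)`. -/
noncomputable def occGrad (P : RLGU S A d m) (θ : EuclideanSpace ℝ (Fin d)) (x : S × A) :
    EuclideanSpace ℝ (Fin d) :=
  (1 - P.disc) • ∑' t : ℕ, P.disc ^ t • P.pairGrad θ t x

/-- The gradient of the objective, by the chain rule. -/
noncomputable def objGrad (P : RLGU S A d m) (θ : EuclideanSpace ℝ (Fin d)) :
    EuclideanSpace ℝ (Fin d) :=
  ∑ x, gradient P.utility (P.occ θ) x • P.occGrad θ x

section Regular

variable {P : RLGU S A d m} {B Lπ : ℝ}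

lemma PolicyRegular.hasFDerivAt_actProb (h : P.PolicyRegular B Lπ)
    (θ : EuclideanSpace ℝ (Fin d)) (x : S × A) :
    HasFDerivAt (fun θ => P.actProb θ x) (P.actProb θ x • innerSL ℝ (P.score θ x.1 x.2)) θ := by
  have hd : DifferentiableAt ℝ (fun θ => P.actProb θ x) θ :=
    ((h.contDiff x.1 x.2).differentiable one_ne_zero) θ
  have hpos : P.actProb θ x ≠ 0 := (h.pos θ x.1 x.2).ne'
  have h1 := (hd.log hpos).hasGradientAt.hasFDerivAt.exp
  have h2 : (fun θ => Real.exp (Real.log (P.actProb θ x))) = fun θ => P.actProb θ x := by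
    ext θ'
    exact Real.exp_log (h.pos θ' x.1 x.2)
  rw [h2, Real.exp_log (show 0 < P.actProb θ x from h.pos θ x.1 x.2)] at h1
  exact h1

lemma PolicyRegular.hasFDerivAt_pairProb (h : P.PolicyRegular B Lπ) (t : ℕ) :
    ∀ (θ : EuclideanSpace ℝ (Fin d)) (x : S × A),
    HasFDerivAt (fun θ => P.pairProb θ t x) (innerSL ℝ (P.pairGrad θ t x)) θ := by
  have key : ∀ t θ, (∀ s, HasFDerivAt (fun θ => P.stateProb θ t s)
      (innerSL ℝ (P.stateGrad θ t s)) θ) → ∀ x,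
      HasFDerivAt (fun θ => P.pairProb θ t x) (innerSL ℝ (P.pairGrad θ t x)) θ := by
    intro t θ hs x
    refine ((hs x.1).mul (h.hasFDerivAt_actProb θ x)).congr_fderiv ?_
    ext u
    simp [pairGrad, pairProb]
    ring
  intro θ
  induction t with
  | zero =>
    refine key 0 θ fun s => ?_
    refine (hasFDerivAt_const (P.stateProb θ 0 s) θ).congr_fderiv ?_
    simp [stateGrad]
  | succ t ih =>
    refine key (t + 1) θ fun s' => ?_
    simp only [stateProb_succ, stateGrad_succ]
    refine (HasFDerivAt.fun_sum fun x _ => (ih x).const_mul (P.transProb x s')).congr_fderiv ?_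
    ext u
    simp

lemma PolicyRegular.sum_norm_pairGrad_le (h : P.PolicyRegular B Lπ)
    (θ : EuclideanSpace ℝ (Fin d)) (t : ℕ) :
    ∑ s, ‖P.stateGrad θ t s‖ ≤ t * B ∧ ∑ x, ‖P.pairGrad θ t x‖ ≤ (t + 1) * B := by
  have key : ∀ t, ∑ s, ‖P.stateGrad θ t s‖ ≤ t * B →
      ∑ x, ‖P.pairGrad θ t x‖ ≤ (t + 1) * B := by
    intro t ht
    calc _ ≤ ∑ x, (P.actProb θ x * ‖P.stateGrad θ t x.1‖ + P.pairProb θ t x * B) := by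
          refine Finset.sum_le_sum fun x _ => (norm_add_le _ _).trans ?_
          rw [norm_smul, norm_smul, Real.norm_of_nonneg (P.actProb_nonneg θ x),
            Real.norm_of_nonneg (P.pairProb_nonneg θ t x)]
          gcongr
          · exact P.pairProb_nonneg θ t x
          · exact h.score_bounded _ _ _
      _ = ∑ s, ‖P.stateGrad θ t s‖ + B := by
          rw [Finset.sum_add_distrib, P.sum_actProb_mul θ fun s => ‖P.stateGrad θ t s‖,
            ← Finset.sum_mul, sum_pairProb, one_mul]
      _ ≤ _ := by linarith
  induction t with
  | zero => exact ⟨by simp [stateGrad], key 0 (by simp [stateGrad])⟩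
  | succ t ih =>
    have h1 : ∑ s, ‖P.stateGrad θ (t + 1) s‖ ≤ ((t + 1 : ℕ) : ℝ) * B := by
      push_cast
      exact (P.sum_norm_transport_le _).trans ih.2
    exact ⟨h1, key _ h1⟩

/-- Total variation distance of policies, by the mean value inequality for the sum of the action
probabilities weighted with the signs of their differences. -/
lemma PolicyRegular.sum_abs_actProb_sub_le (h : P.PolicyRegular B Lπ)
    (θ θ' : EuclideanSpace ℝ (Fin d)) (s : S) :
    ∑ a, |P.actProb θ (s, a) - P.actProb θ' (s, a)| ≤ B * ‖θ - θ'‖ := by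
  set σ : A → ℝ := fun a => SignType.sign (P.actProb θ (s, a) - P.actProb θ' (s, a)) with hσ
  have hσ1 : ∀ a, |σ a| ≤ 1 := fun a => by
    simp only [hσ]
    rcases SignType.sign (P.actProb θ (s, a) - P.actProb θ' (s, a)) <;> simp
  have hd : ∀ φ ∈ Set.univ, HasFDerivWithinAt (fun φ => ∑ a, σ a * P.actProb φ (s, a))
      (∑ a, σ a • (P.actProb φ (s, a) • innerSL ℝ (P.score φ s a))) Set.univ φ := fun φ _ =>
    (HasFDerivAt.fun_sum fun a _ =>
      (h.hasFDerivAt_actProb φ (s, a)).const_mul (σ a)).hasFDerivWithinAt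
  have hb : ∀ φ ∈ (Set.univ : Set (EuclideanSpace ℝ (Fin d))),
      ‖∑ a, σ a • (P.actProb φ (s, a) • innerSL ℝ (P.score φ s a))‖ ≤ B := fun φ _ => by
    calc _ ≤ ∑ a, 1 * (P.actProb φ (s, a) * B) := by
          refine (norm_sum_le _ _).trans (Finset.sum_le_sum fun a _ => ?_)
          rw [norm_smul, norm_smul, innerSL_apply_norm, Real.norm_eq_abs,
            Real.norm_of_nonneg (P.actProb_nonneg φ _)]
          have := P.actProb_nonneg φ (s, a)
          gcongr
          · exact hσ1 a
          · exact h.score_bounded _ _ _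
      _ = B := by rw [← Finset.mul_sum, ← Finset.sum_mul, sum_actProb, one_mul, one_mul]
  have h1 := convex_univ.norm_image_sub_le_of_norm_hasFDerivWithin_le hd hb
    (Set.mem_univ θ') (Set.mem_univ θ)
  refine le_trans (le_of_eq ?_) ((Real.le_norm_self _).trans h1)
  rw [← Finset.sum_sub_distrib]
  refine Finset.sum_congr rfl fun a _ => ?_
  rw [← mul_sub, hσ, sign_mul_self]

lemma PolicyRegular.sum_abs_actProb_sub_mul_le (h : P.PolicyRegular B Lπ)
    (θ θ' : EuclideanSpace ℝ (Fin d)) {f : S → ℝ} (hf : ∀ s, 0 ≤ f s) :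
    ∑ x : S × A, |P.actProb θ x - P.actProb θ' x| * f x.1 ≤ B * ‖θ - θ'‖ * ∑ s, f s := by
  rw [Fintype.sum_prod_type, Finset.mul_sum]
  refine Finset.sum_le_sum fun s _ => ?_
  change ∑ a, |P.actProb θ (s, a) - P.actProb θ' (s, a)| * f s ≤ _
  rw [← Finset.sum_mul]
  exact mul_le_mul_of_nonneg_right (h.sum_abs_actProb_sub_le θ θ' s) (hf s)

lemma PolicyRegular.sum_abs_pairProb_sub_le (h : P.PolicyRegular B Lπ)
    (θ θ' : EuclideanSpace ℝ (Fin d)) (t : ℕ) :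
    ∑ x, |P.pairProb θ t x - P.pairProb θ' t x| ≤ (t + 1) * B * ‖θ - θ'‖ := by
  have key : ∀ t, ∑ s, |P.stateProb θ t s - P.stateProb θ' t s| ≤ t * B * ‖θ - θ'‖ →
      ∑ x, |P.pairProb θ t x - P.pairProb θ' t x| ≤ (t + 1) * B * ‖θ - θ'‖ := by
    intro t ht
    calc _ ≤ ∑ x : S × A, (P.actProb θ x * |P.stateProb θ t x.1 - P.stateProb θ' t x.1|
          + |P.actProb θ x - P.actProb θ' x| * P.stateProb θ' t x.1) := by
          refine Finset.sum_le_sum fun x _ => ?_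
          rw [← abs_of_nonneg (P.actProb_nonneg θ x), ← abs_of_nonneg (P.stateProb_nonneg θ' t x.1),
            ← abs_mul, ← abs_mul, abs_of_nonneg (P.actProb_nonneg θ x),
            abs_of_nonneg (P.stateProb_nonneg θ' t x.1)]
          refine le_trans (le_of_eq ?_) (abs_add_le _ _)
          congr 1
          simp only [pairProb]
          ring
      _ ≤ t * B * ‖θ - θ'‖ + B * ‖θ - θ'‖ * 1 := by
          rw [Finset.sum_add_distrib,
            P.sum_actProb_mul θ fun s => |P.stateProb θ t s - P.stateProb θ' t s|]
          refine add_le_add ht ?_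
          have := h.sum_abs_actProb_sub_mul_le θ θ' (P.stateProb_nonneg θ' t)
          rwa [sum_stateProb] at this
      _ = _ := by ring
  induction t with
  | zero => exact key 0 (by simp [stateProb, stateLaw])
  | succ t ih =>
    refine key (t + 1) ?_
    push_cast
    refine le_trans (le_of_eq ?_) ((P.sum_norm_transport_le
      (fun x => P.pairProb θ t x - P.pairProb θ' t x)).trans ih)
    simp only [stateProb_succ, ← Finset.sum_sub_distrib, ← mul_sub, Real.norm_eq_abs, smul_eq_mul]

/-- The Lipschitz constant of the derivative of the law of `(s_t, a_t)`, in total variation. -/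
lemma PolicyRegular.sum_norm_pairGrad_sub_le (h : P.PolicyRegular B Lπ) (hB : 0 ≤ B)
    (θ θ' : EuclideanSpace ℝ (Fin d)) (t : ℕ) :
    ∑ x, ‖P.pairGrad θ t x - P.pairGrad θ' t x‖ ≤
      (((t : ℝ) + 1) ^ 2 * B ^ 2 + (t + 1) * Lπ) * ‖θ - θ'‖ := by
  have key : ∀ t : ℕ, ∑ s, ‖P.stateGrad θ t s - P.stateGrad θ' t s‖ ≤
        ((t : ℝ) ^ 2 * B ^ 2 + t * Lπ) * ‖θ - θ'‖ →
      ∑ x, ‖P.pairGrad θ t x - P.pairGrad θ' t x‖ ≤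
        (((t : ℝ) + 1) ^ 2 * B ^ 2 + (t + 1) * Lπ) * ‖θ - θ'‖ := by
    intro t ht
    have hsplit : ∀ x, P.pairGrad θ t x - P.pairGrad θ' t x =
        P.actProb θ x • (P.stateGrad θ t x.1 - P.stateGrad θ' t x.1)
        + (P.actProb θ x - P.actProb θ' x) • P.stateGrad θ' t x.1
        + (P.pairProb θ t x - P.pairProb θ' t x) • P.score θ x.1 x.2
        + P.pairProb θ' t x • (P.score θ x.1 x.2 - P.score θ' x.1 x.2) := fun x => by
      simp only [pairGrad]
      module
    have hbound : ∀ x, ‖P.pairGrad θ t x - P.pairGrad θ' t x‖ ≤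
        P.actProb θ x * ‖P.stateGrad θ t x.1 - P.stateGrad θ' t x.1‖
        + |P.actProb θ x - P.actProb θ' x| * ‖P.stateGrad θ' t x.1‖
        + |P.pairProb θ t x - P.pairProb θ' t x| * B
        + P.pairProb θ' t x * (Lπ * ‖θ - θ'‖) := fun x => by
      rw [hsplit]
      refine norm_add₄_le.trans ?_
      simp only [norm_smul, Real.norm_eq_abs, abs_of_nonneg (P.actProb_nonneg θ x),
        abs_of_nonneg (P.pairProb_nonneg θ' t x)]
      have := P.pairProb_nonneg θ' t x
      gcongr
      · exact h.score_bounded _ _ _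
      · exact h.score_lipschitz _ _ _ _
    refine (Finset.sum_le_sum fun x _ => hbound x).trans ?_
    simp only [Finset.sum_add_distrib, ← Finset.sum_mul]
    rw [P.sum_actProb_mul θ fun s => ‖P.stateGrad θ t s - P.stateGrad θ' t s‖, sum_pairProb]
    have h1 := h.sum_abs_actProb_sub_mul_le θ θ' (f := fun s => ‖P.stateGrad θ' t s‖)
      fun s => norm_nonneg _
    have h2 := mul_le_mul_of_nonneg_left (h.sum_norm_pairGrad_le θ' t).1
      (mul_nonneg hB (norm_nonneg (θ - θ')))
    have h3 := mul_le_mul_of_nonneg_right (h.sum_abs_pairProb_sub_le θ θ' t) hB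
    nlinarith
  induction t with
  | zero => exact key 0 (by simp [stateGrad])
  | succ t ih =>
    refine key (t + 1) ?_
    push_cast
    refine le_trans (le_of_eq ?_) ((P.sum_norm_transport_le
      (fun x => P.pairGrad θ t x - P.pairGrad θ' t x)).trans ih)
    simp only [stateGrad_succ, ← Finset.sum_sub_distrib, ← smul_sub]

lemma hasSum_discounted (P : RLGU S A d m) (B : ℝ) :
    HasSum (fun t : ℕ => P.disc ^ t * (((t : ℝ) + 1) * B)) (B / (1 - P.disc) ^ 2) := by
  have h := (hasSum_pow_mul_add_one P.disc_pos P.disc_lt_one).mul_right B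
  rw [one_div_mul_eq_div] at h
  simpa only [mul_assoc] using h

lemma PolicyRegular.summable_pairGrad (h : P.PolicyRegular B Lπ)
    (θ : EuclideanSpace ℝ (Fin d)) (x : S × A) :
    Summable fun t => P.disc ^ t • P.pairGrad θ t x :=
  summable_smul_discounted P.disc_pos (fun t => (h.sum_norm_pairGrad_le θ t).2)
    (hasSum_discounted P B).summable x

lemma summable_pairProb (P : RLGU S A d m) (θ : EuclideanSpace ℝ (Fin d)) (x : S × A) :
    Summable fun t => P.disc ^ t • P.pairProb θ t x :=
  summable_smul_discounted P.disc_pos (c := fun _ => 1)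
    (fun t => by simp [abs_of_nonneg (P.pairProb_nonneg θ t _), sum_pairProb])
    (by simpa using summable_geometric_of_lt_one P.disc_pos.le P.disc_lt_one) x

lemma PolicyRegular.hasFDerivAt_occ (h : P.PolicyRegular B Lπ)
    (θ : EuclideanSpace ℝ (Fin d)) (x : S × A) :
    HasFDerivAt (fun θ => P.occ θ x) (innerSL ℝ (P.occGrad θ x)) θ := by
  have hγ := P.disc_pos
  have h1 := hasFDerivAt_tsum (hasSum_discounted P B).summable
    (f := fun t θ => P.disc ^ t * P.pairProb θ t x)
    (f' := fun t θ => P.disc ^ t • innerSL ℝ (P.pairGrad θ t x)) (x₀ := θ)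
    (fun t φ => (h.hasFDerivAt_pairProb t φ x).const_mul _)
    (fun t φ => by
      rw [norm_smul, innerSL_apply_norm, norm_pow, Real.norm_of_nonneg hγ.le]
      refine mul_le_mul_of_nonneg_left ?_ (by positivity)
      exact (Finset.single_le_sum (f := fun x => ‖P.pairGrad φ t x‖) (fun _ _ => norm_nonneg _)
        (Finset.mem_univ x)).trans (h.sum_norm_pairGrad_le φ t).2)
    (P.summable_pairProb θ x) θ
  simp only [occ_apply]
  refine (h1.const_mul _).congr_fderiv ?_
  have h2 := (h.summable_pairGrad θ x).map_tsum (innerSL ℝ) (innerSL ℝ).continuous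
  simp only [map_smul] at h2
  rw [occGrad, map_smul, h2]

lemma PolicyRegular.sum_norm_occGrad_le (h : P.PolicyRegular B Lπ)
    (θ : EuclideanSpace ℝ (Fin d)) : ∑ x, ‖P.occGrad θ x‖ ≤ B / (1 - P.disc) := by
  have hγ : 0 < 1 - P.disc := sub_pos.2 P.disc_lt_one
  have h1 := sum_norm_tsum_le P.disc_pos (fun t => (h.sum_norm_pairGrad_le θ t).2)
    (hasSum_discounted P B)
  simp only [occGrad, norm_smul, Real.norm_of_nonneg hγ.le, ← Finset.mul_sum]
  refine (mul_le_mul_of_nonneg_left h1 hγ.le).trans (le_of_eq ?_)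
  field_simp

lemma PolicyRegular.sum_abs_occ_sub_le (h : P.PolicyRegular B Lπ)
    (θ θ' : EuclideanSpace ℝ (Fin d)) :
    ∑ x, |P.occ θ x - P.occ θ' x| ≤ B / (1 - P.disc) * ‖θ - θ'‖ := by
  have hγ : 0 < 1 - P.disc := sub_pos.2 P.disc_lt_one
  have h1 := sum_norm_tsum_le P.disc_pos (v := fun t x => P.pairProb θ t x - P.pairProb θ' t x)
    (fun t => (h.sum_abs_pairProb_sub_le θ θ' t).trans_eq (mul_assoc _ _ _))
    (hasSum_discounted P (B * ‖θ - θ'‖))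
  have h2 : ∀ x, P.occ θ x - P.occ θ' x =
      (1 - P.disc) * ∑' t, P.disc ^ t • (P.pairProb θ t x - P.pairProb θ' t x) := fun x => by
    simp only [occ_apply, smul_sub]
    rw [(P.summable_pairProb θ x).tsum_sub (P.summable_pairProb θ' x), mul_sub]
    rfl
  simp only [h2, abs_mul, abs_of_pos hγ, ← Finset.mul_sum]
  refine (mul_le_mul_of_nonneg_left h1 hγ.le).trans (le_of_eq ?_)
  field_simp

lemma PolicyRegular.sum_norm_occGrad_sub_le (h : P.PolicyRegular B Lπ) (hB : 0 ≤ B)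
    (θ θ' : EuclideanSpace ℝ (Fin d)) :
    ∑ x, ‖P.occGrad θ x - P.occGrad θ' x‖ ≤
      (2 * B ^ 2 / (1 - P.disc) ^ 2 + Lπ / (1 - P.disc)) * ‖θ - θ'‖ := by
  have hγ : 0 < 1 - P.disc := sub_pos.2 P.disc_lt_one
  have hs := ((hasSum_pow_mul_add_two_mul_add_one P.disc_pos P.disc_lt_one).mul_right
    (B ^ 2 * ‖θ - θ'‖)).add (hasSum_discounted P (Lπ * ‖θ - θ'‖))
  simp only [mul_assoc, ← mul_add] at hs
  simp only [← mul_assoc (_ + 2 : ℝ)] at hs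
  have h1 := sum_norm_tsum_le P.disc_pos (v := fun t x => P.pairGrad θ t x - P.pairGrad θ' t x)
    (c := fun t => ((t : ℝ) + 2) * (t + 1) * (B ^ 2 * ‖θ - θ'‖) + (t + 1) * (Lπ * ‖θ - θ'‖))
    (fun t => by
      refine (h.sum_norm_pairGrad_sub_le hB θ θ' t).trans ?_
      have : 0 ≤ ((t : ℝ) + 1) * (B ^ 2 * ‖θ - θ'‖) := by positivity
      nlinarith) hs
  have h2 : ∀ x, P.occGrad θ x - P.occGrad θ' x =
      (1 - P.disc) • ∑' t, P.disc ^ t • (P.pairGrad θ t x - P.pairGrad θ' t x) := fun x => by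
    simp only [occGrad, smul_sub]
    rw [(h.summable_pairGrad θ x).tsum_sub (h.summable_pairGrad θ' x), smul_sub]
  simp only [h2, norm_smul, Real.norm_of_nonneg hγ.le, ← Finset.mul_sum]
  refine (mul_le_mul_of_nonneg_left h1 hγ.le).trans (le_of_eq ?_)
  field_simp

/-- The truncation error of the gradient of the occupancy measure at horizon `H`. -/
lemma PolicyRegular.sum_norm_truncated_sub_occGrad_le (h : P.PolicyRegular B Lπ) (hB : 0 ≤ B)
    (θ : EuclideanSpace ℝ (Fin d)) (H : ℕ) :
    ∑ x, ‖(1 - P.disc) • ∑ t ∈ Finset.range H, P.disc ^ t • P.pairGrad θ t x - P.occGrad θ x‖ ≤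
      B / (1 - P.disc) * (P.disc ^ H * (H + 1)) := by
  have hγ : 0 < 1 - P.disc := sub_pos.2 P.disc_lt_one
  have h0 := P.disc_pos
  have h1 := sum_norm_tsum_le P.disc_pos (v := fun t x => P.disc ^ H • P.pairGrad θ (t + H) x)
    (c := fun t => ((t : ℝ) + 1) * (B * (P.disc ^ H * (H + 1))))
    (fun t => by
      simp only [norm_smul, norm_pow, Real.norm_of_nonneg h0.le, ← Finset.mul_sum]
      have h2 := (h.sum_norm_pairGrad_le θ (t + H)).2
      push_cast at h2
      have h3 : ((t : ℝ) + H + 1) * B ≤ ((t : ℝ) + 1) * (H + 1) * B :=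
        mul_le_mul_of_nonneg_right
          (by nlinarith [Nat.cast_nonneg (α := ℝ) t, Nat.cast_nonneg (α := ℝ) H,
            mul_nonneg (Nat.cast_nonneg (α := ℝ) t) (Nat.cast_nonneg (α := ℝ) H)]) hB
      refine (mul_le_mul_of_nonneg_left (h2.trans h3) (by positivity)).trans (le_of_eq ?_)
      ring) (hasSum_discounted P _)
  have h2 : ∀ x, (1 - P.disc) • ∑ t ∈ Finset.range H, P.disc ^ t • P.pairGrad θ t x
      - P.occGrad θ x =
      -((1 - P.disc) • ∑' t, P.disc ^ t • P.disc ^ H • P.pairGrad θ (t + H) x) := fun x => by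
    rw [occGrad, ← (h.summable_pairGrad θ x).sum_add_tsum_nat_add H, smul_add]
    simp only [smul_smul, pow_add]
    module
  simp only [h2, norm_neg, norm_smul, Real.norm_of_nonneg hγ.le, ← Finset.mul_sum]
  refine (mul_le_mul_of_nonneg_left h1 hγ.le).trans (le_of_eq ?_)
  field_simp

lemma occ_mem_measureClass {Bω BL : ℝ} (hC : P.ClassRegular Bω BL)
    (θ : EuclideanSpace ℝ (Fin d)) : P.occ θ ∈ P.measureClass := by
  obtain ⟨ω, hω, h⟩ := hC.realizable θ
  exact ⟨ω, hω, θ, by rw [occ, h]⟩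

lemma hasFDerivAt_objective {Bω BL lF LF : ℝ} (hC : P.ClassRegular Bω BL)
    (hP : P.PolicyRegular B Lπ) (hU : P.UtilitySmooth lF LF) (θ : EuclideanSpace ℝ (Fin d)) :
    HasFDerivAt P.objective (innerSL ℝ (P.objGrad θ)) θ := by
  have h1 := (hU.differentiable _ (occ_mem_measureClass hC θ)).hasGradientAt.hasFDerivAt
  have h2 : HasFDerivAt P.occ (
      (PiLp.continuousLinearEquiv 2 ℝ fun _ : S × A => ℝ).symm.toContinuousLinearMap ∘L
        ContinuousLinearMap.pi fun x => innerSL ℝ (P.occGrad θ x)) θ := by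
    rw [← hasFDerivWithinAt_univ, hasFDerivWithinAt_euclidean]
    intro x
    exact ((hP.hasFDerivAt_occ θ x).congr_fderiv (by ext u; simp)).hasFDerivWithinAt
  refine (h1.comp θ h2).congr_fderiv ?_
  ext u
  change inner ℝ (gradient P.utility (P.occ θ)) _ = inner ℝ (P.objGrad θ) u
  rw [objGrad, sum_inner, PiLp.inner_apply]
  refine Finset.sum_congr rfl fun x _ => ?_
  rw [real_inner_smul_left]
  exact mul_comm _ _

/-- The objective is smooth, with constant `(1 - γ) L_θ`. -/
lemma norm_objGrad_sub_le {Bω BL lF LF : ℝ} (hC : P.ClassRegular Bω BL)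
    (hP : P.PolicyRegular B Lπ) (hU : P.UtilitySmooth lF LF) (hB : 0 ≤ B)
    (hlF : 0 ≤ lF) (hLF : 0 ≤ LF) (θ θ' : EuclideanSpace ℝ (Fin d)) :
    ‖P.objGrad θ - P.objGrad θ'‖ ≤
      (1 - P.disc) * smoothnessConst P.disc B Lπ lF LF * ‖θ - θ'‖ := by
  have hγ : 0 < 1 - P.disc := sub_pos.2 P.disc_lt_one
  have hγ1 : 1 - P.disc ≤ 1 := by linarith [P.disc_pos]
  have hm := occ_mem_measureClass hC θ
  have hm' := occ_mem_measureClass hC θ'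
  have hsplit : P.objGrad θ - P.objGrad θ' =
      ∑ x, (gradient P.utility (P.occ θ) - gradient P.utility (P.occ θ')) x • P.occGrad θ x
      + ∑ x, gradient P.utility (P.occ θ') x • (P.occGrad θ x - P.occGrad θ' x) := by
    simp only [objGrad, ← Finset.sum_sub_distrib, ← Finset.sum_add_distrib, PiLp.sub_apply]
    refine Finset.sum_congr rfl fun x _ => ?_
    module
  have h1 : ‖P.occ θ - P.occ θ'‖ ≤ B / (1 - P.disc) * ‖θ - θ'‖ :=
    (norm_le_sum_abs _).trans (hP.sum_abs_occ_sub_le θ θ')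
  have h2 := norm_sum_smul_le
    (r := fun x => (gradient P.utility (P.occ θ) - gradient P.utility (P.occ θ')) x)
    (fun x => (abs_apply_le_norm _ x).trans ((hU.gradient_lipschitz _ hm _ hm').trans
      (mul_le_mul_of_nonneg_left h1 hLF))) (by positivity) (hP.sum_norm_occGrad_le θ)
  have h3 := norm_sum_smul_le (r := fun x => gradient P.utility (P.occ θ') x)
    (fun x => (abs_apply_le_norm _ x).trans (hU.gradient_bounded _ hm')) hlF
    (hP.sum_norm_occGrad_sub_le hB θ θ')
  rw [hsplit]
  refine (norm_add_le _ _).trans ((add_le_add h2 h3).trans ?_)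
  have h4 : LF * B ^ 2 / (1 - P.disc) ^ 2 ≤ LF * B ^ 2 / (1 - P.disc) ^ 3 := by
    refine div_le_div_of_nonneg_left (by positivity) (by positivity) ?_
    exact pow_le_pow_of_le_one hγ.le hγ1 (by norm_num)
  have h5 : (1 - P.disc) * smoothnessConst P.disc B Lπ lF LF =
      LF * B ^ 2 / (1 - P.disc) ^ 3 + 2 * B ^ 2 * lF / (1 - P.disc) ^ 2
        + lF * Lπ / (1 - P.disc) := by
    unfold smoothnessConst
    field_simp
  rw [h5]
  have h6 := mul_le_mul_of_nonneg_right h4 (norm_nonneg (θ - θ'))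
  calc _ = LF * B ^ 2 / (1 - P.disc) ^ 2 * ‖θ - θ'‖
        + (2 * B ^ 2 * lF / (1 - P.disc) ^ 2 + lF * Lπ / (1 - P.disc)) * ‖θ - θ'‖ := by
        field_simp
    _ ≤ LF * B ^ 2 / (1 - P.disc) ^ 3 * ‖θ - θ'‖
        + (2 * B ^ 2 * lF / (1 - P.disc) ^ 2 + lF * Lπ / (1 - P.disc)) * ‖θ - θ'‖ := by
        linarith
    _ = _ := by ring

end Regular

end RLGU

/-! ### The truncated policy gradient estimate -/

namespace RLGU

variable {S A : Type*} [Fintype S] [Fintype A] {d m : ℕ}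

/-- The discounted return of a trajectory for the reward `r`. -/
noncomputable def discReturn (P : RLGU S A d m) {H : ℕ} (τ : Fin H → S × A)
    (r : EuclideanSpace ℝ (S × A)) : ℝ :=
  ∑ h : Fin H, P.disc ^ (h : ℕ) * r (τ h)

section Cons

variable (P : RLGU S A d m) (θ : EuclideanSpace ℝ (Fin d)) (r : EuclideanSpace ℝ (S × A))

lemma discReturn_cons {H : ℕ} (x : S × A) (τ : Fin H → S × A) :
    P.discReturn (Fin.cons (α := fun _ => S × A) x τ : Fin (H + 1) → S × A) r =
      r x + P.disc * P.discReturn τ r := by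
  simp [discReturn, Fin.sum_univ_succ, pow_succ', Finset.mul_sum, mul_assoc]

lemma pgEstimate_cons {H : ℕ} (x : S × A) (τ : Fin H → S × A) :
    P.pgEstimate (Fin.cons (α := fun _ => S × A) x τ : Fin (H + 1) → S × A) θ r =
      (r x + P.disc * P.discReturn τ r) • P.score θ x.1 x.2 + P.disc • P.pgEstimate τ θ r := by
  have hIci : ∀ {n : ℕ} (t : Fin n) (f : Fin n → ℝ),
      ∑ h ∈ Finset.Ici t, f h = ∑ h, if t ≤ h then f h else 0 := fun t f => by
    rw [← Finset.sum_filter]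
    congr 1
    ext h
    simp
  rw [← discReturn_cons]
  simp only [pgEstimate, hIci, Fin.sum_univ_succ (n := H), Finset.smul_sum, smul_smul]
  congr 1
  · simp [discReturn, Fin.sum_univ_succ]
  · refine Finset.sum_congr rfl fun t _ => ?_
    congr 1
    simp [Finset.mul_sum, pow_succ', mul_assoc]

lemma mean_trajFrom_succ {E : Type*} [NormedAddCommGroup E] [InnerProductSpace ℝ E] (H : ℕ) (s : S)
    (f : (Fin (H + 1) → S × A) → E) :
    (P.trajFrom θ (H + 1) s).mean f = ∑ a, P.actProb θ (s, a) • ∑ s', P.transProb (s, a) s' •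
      (P.trajFrom θ H s').mean fun τ => f (Fin.cons (α := fun _ => S × A) (s, a) τ) := by
  rw [trajFrom, PMF.mean_bind]
  simp only [PMF.mean_bind, PMF.mean_map, Function.comp_def]
  rfl

/-- The expected truncated return from the state `s`. -/
noncomputable def value (H : ℕ) (s : S) : ℝ :=
  (P.trajFrom θ H s).mean fun τ => P.discReturn τ r

/-- The expected truncated return from the pair `x = (s, a)`, with `H` more steps. -/
noncomputable def actionValue (H : ℕ) (x : S × A) : ℝ :=
  r x + P.disc * ∑ s', P.transProb x s' * P.value θ r H s'

/-- The expected truncated policy gradient estimate from the state `s`. -/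
noncomputable def meanEstimate (H : ℕ) (s : S) : EuclideanSpace ℝ (Fin d) :=
  (P.trajFrom θ H s).mean fun τ => P.pgEstimate τ θ r

lemma value_succ (H : ℕ) (s : S) :
    P.value θ r (H + 1) s = ∑ a, P.actProb θ (s, a) * P.actionValue θ r H (s, a) := by
  rw [value, mean_trajFrom_succ]
  refine Finset.sum_congr rfl fun a _ => ?_
  simp only [discReturn_cons, PMF.mean_add, PMF.mean_const, PMF.mean_const_mul, smul_eq_mul,
    mul_add, Finset.sum_add_distrib, ← Finset.sum_mul, sum_transProb, actionValue, value,
    Finset.mul_sum, one_mul]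
  congr 1
  refine Finset.sum_congr rfl fun s' _ => ?_
  ring

lemma meanEstimate_succ (H : ℕ) (s : S) :
    P.meanEstimate θ r (H + 1) s = ∑ a, P.actProb θ (s, a) •
      (P.actionValue θ r H (s, a) • P.score θ s a +
        P.disc • ∑ s', P.transProb (s, a) s' • P.meanEstimate θ r H s') := by
  rw [meanEstimate, mean_trajFrom_succ]
  refine Finset.sum_congr rfl fun a _ => ?_
  congr 1
  have h : ∀ s', (P.trajFrom θ H s').mean (fun τ => P.pgEstimate
      (Fin.cons (α := fun _ => S × A) (s, a) τ : Fin (H + 1) → S × A) θ r) =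
      (r (s, a) + P.disc * P.value θ r H s') • P.score θ s a
        + P.disc • P.meanEstimate θ r H s' := fun s' => by
    simp only [pgEstimate_cons]
    rw [PMF.mean_add, PMF.mean_smul_const, PMF.mean_smul, PMF.mean_add, PMF.mean_const,
      PMF.mean_const_mul]
    rfl
  simp only [h, smul_add, Finset.sum_add_distrib]
  congr 1
  · simp only [smul_smul, ← Finset.sum_smul, actionValue]
    congr 1
    simp only [mul_add, Finset.sum_add_distrib, ← Finset.sum_mul, sum_transProb, one_mul,
      Finset.mul_sum]
    congr 1
    refine Finset.sum_congr rfl fun s' _ => ?_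
    ring
  · rw [Finset.smul_sum]
    exact Finset.sum_congr rfl fun s' _ => smul_comm _ _ _

/-- The policy gradient theorem at a finite horizon: a backward recursion along the trajectory for
the left side, a forward recursion in time for the derivative of the law of `(s_t, a_t)`. -/
lemma sum_meanEstimate_add (H k : ℕ) :
    ∑ s, (P.stateProb θ k s • P.meanEstimate θ r H s + P.value θ r H s • P.stateGrad θ k s) =
      ∑ h ∈ Finset.range H, P.disc ^ h • ∑ x, r x • P.pairGrad θ (k + h) x := by
  induction H generalizing k with
  | zero =>
    simp [meanEstimate, value, trajFrom, PMF.mean_pure, pgEstimate, discReturn]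
  | succ H ih =>
    rw [Finset.sum_range_succ']
    have h1 : ∑ h ∈ Finset.range H, P.disc ^ (h + 1) • ∑ x, r x • P.pairGrad θ (k + (h + 1)) x =
        P.disc • ∑ h ∈ Finset.range H, P.disc ^ h • ∑ x, r x • P.pairGrad θ (k + 1 + h) x := by
      rw [Finset.smul_sum]
      refine Finset.sum_congr rfl fun h _ => ?_
      rw [pow_succ', mul_smul, show k + (h + 1) = k + 1 + h by ring]
    rw [h1, ← ih (k + 1), pow_zero, one_smul, add_zero]
    have h2 : ∑ s, (P.stateProb θ k s • P.meanEstimate θ r (H + 1) s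
        + P.value θ r (H + 1) s • P.stateGrad θ k s) =
        ∑ x : S × A, (P.actionValue θ r H x • P.pairGrad θ k x +
          P.disc • ∑ s', (P.transProb x s' * P.pairProb θ k x) • P.meanEstimate θ r H s') := by
      rw [Fintype.sum_prod_type]
      refine Finset.sum_congr rfl fun s _ => ?_
      rw [meanEstimate_succ, value_succ, Finset.smul_sum, Finset.sum_smul,
        ← Finset.sum_add_distrib]
      refine Finset.sum_congr rfl fun a _ => ?_
      simp only [mul_comm (P.transProb _ _), mul_smul, ← Finset.smul_sum, pairGrad, pairProb]
      module
    rw [h2]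
    simp only [actionValue, add_smul, Finset.sum_add_distrib]
    rw [add_comm (P.disc • _) (∑ x, _), add_assoc]
    congr 1
    simp only [mul_smul, ← Finset.smul_sum, ← smul_add]
    congr 1
    rw [add_comm, Finset.sum_comm]
    simp only [stateProb_succ, stateGrad_succ, Finset.sum_smul,
      Finset.smul_sum, mul_smul]
    congr 1
    rw [Finset.sum_comm]
    refine Finset.sum_congr rfl fun s' _ => Finset.sum_congr rfl fun x _ => ?_
    rw [smul_comm]

lemma mean_traj_pgEstimate (H : ℕ) :
    ((P.traj θ H).mean fun τ => P.pgEstimate τ θ r) =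
      ∑ h ∈ Finset.range H, P.disc ^ h • ∑ x, r x • P.pairGrad θ h x := by
  have h := P.sum_meanEstimate_add θ r H 0
  simp only [zero_add, stateGrad, smul_zero, add_zero] at h
  rw [← h, traj, PMF.mean_bind]
  rfl

end Cons

lemma abs_discReturn_le (P : RLGU S A d m) {r : EuclideanSpace ℝ (S × A)} {c : ℝ}
    (hr : ∀ x, |r x| ≤ c) {H : ℕ} (τ : Fin H → S × A) :
    |P.discReturn τ r| ≤ c / (1 - P.disc) := by
  have hγ : 0 < 1 - P.disc := sub_pos.2 P.disc_lt_one
  induction H with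
  | zero =>
    obtain ⟨x, -⟩ := P.init.support_nonempty
    obtain ⟨a, -⟩ := (P.policy 0 x).support_nonempty
    have hc : 0 ≤ c := (abs_nonneg _).trans (hr (x, a))
    simpa [discReturn] using div_nonneg hc hγ.le
  | succ H ih =>
    rw [← Fin.cons_self_tail τ, discReturn_cons]
    have h0 := P.disc_pos
    calc _ ≤ c + P.disc * (c / (1 - P.disc)) := by
          refine (abs_add_le _ _).trans (add_le_add (hr _) ?_)
          rw [abs_mul, abs_of_pos h0]
          exact mul_le_mul_of_nonneg_left (ih _) h0.le
      _ = _ := by field_simp; ring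

lemma norm_pgEstimate_le {P : RLGU S A d m} {B Lπ : ℝ} (hP : P.PolicyRegular B Lπ) (hB : 0 ≤ B)
    {r : EuclideanSpace ℝ (S × A)} {c : ℝ} (hc : 0 ≤ c) (hr : ∀ x, |r x| ≤ c) {H : ℕ}
    (τ : Fin H → S × A) (θ : EuclideanSpace ℝ (Fin d)) :
    ‖P.pgEstimate τ θ r‖ ≤ c * B / (1 - P.disc) ^ 2 := by
  have hγ : 0 < 1 - P.disc := sub_pos.2 P.disc_lt_one
  have h0 := P.disc_pos
  induction H with
  | zero => simpa [pgEstimate] using by positivity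
  | succ H ih =>
    rw [← Fin.cons_self_tail τ, pgEstimate_cons, ← discReturn_cons]
    calc _ ≤ c / (1 - P.disc) * B + P.disc * (c * B / (1 - P.disc) ^ 2) := by
          refine (norm_add_le _ _).trans (add_le_add ?_ ?_)
          · rw [norm_smul]
            exact mul_le_mul (P.abs_discReturn_le hr _) (hP.score_bounded _ _ _) (norm_nonneg _)
              (by positivity)
          · rw [norm_smul, Real.norm_of_nonneg h0.le]
            exact mul_le_mul_of_nonneg_left (ih _) h0.le
      _ = _ := by field_simp; ring

end RLGU

/-! ### One iteration of the algorithm -/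

namespace RLGU

variable {S A : Type*} [Fintype S] [Fintype A] {d m : ℕ} {P : RLGU S A d m}
  {B Lπ lF LF Bω BL : ℝ}

/-- The estimate of the gradient of the objective used by the algorithm. The factor `1 - γ` accounts
for the normalization of the occupancy measures. -/
noncomputable def gradEstimate (P : RLGU S A d m) {N H : ℕ} (θ : EuclideanSpace ℝ (Fin d))
    (r : EuclideanSpace ℝ (S × A)) (τ : Fin N → Fin H → S × A) : EuclideanSpace ℝ (Fin d) :=
  (N : ℝ)⁻¹ • ∑ i, (1 - P.disc) • P.pgEstimate (τ i) θ r

/-- The bias of the gradient estimate: truncation at horizon `H`, and error of the reward. -/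
lemma norm_mean_pgEstimate_sub_objGrad_le (hP : P.PolicyRegular B Lπ) (hB : 0 ≤ B) (hlF : 0 ≤ lF)
    (θ : EuclideanSpace ℝ (Fin d)) {r : EuclideanSpace ℝ (S × A)} (hr : ‖r‖ ≤ lF) (H : ℕ) :
    ‖((P.traj θ H).mean fun τ => (1 - P.disc) • P.pgEstimate τ θ r) - P.objGrad θ‖ ≤
      lF * (B / (1 - P.disc) * (P.disc ^ H * (H + 1))) +
        ‖r - gradient P.utility (P.occ θ)‖ * (B / (1 - P.disc)) := by
  have hsplit : ((P.traj θ H).mean fun τ => (1 - P.disc) • P.pgEstimate τ θ r) - P.objGrad θ =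
      ∑ x, r x • ((1 - P.disc) • ∑ t ∈ Finset.range H, P.disc ^ t • P.pairGrad θ t x
        - P.occGrad θ x)
      + ∑ x, (r - gradient P.utility (P.occ θ)) x • P.occGrad θ x := by
    have h1 : (1 - P.disc) • ∑ h ∈ Finset.range H, P.disc ^ h • ∑ x, r x • P.pairGrad θ h x =
        ∑ x, r x • (1 - P.disc) • ∑ t ∈ Finset.range H, P.disc ^ t • P.pairGrad θ t x := by
      simp only [Finset.smul_sum]
      rw [Finset.sum_comm]
      refine Finset.sum_congr rfl fun x _ => Finset.sum_congr rfl fun t _ => ?_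
      module
    rw [PMF.mean_smul, mean_traj_pgEstimate, objGrad, h1, ← Finset.sum_add_distrib,
      ← Finset.sum_sub_distrib]
    refine Finset.sum_congr rfl fun x _ => ?_
    rw [PiLp.sub_apply]
    module
  rw [hsplit]
  refine (norm_add_le _ _).trans (add_le_add ?_ ?_)
  · exact norm_sum_smul_le (fun x => (abs_apply_le_norm _ x).trans hr) hlF
      (hP.sum_norm_truncated_sub_occGrad_le hB θ H)
  · exact norm_sum_smul_le (fun x => abs_apply_le_norm _ x) (norm_nonneg _)
      (hP.sum_norm_occGrad_le θ)

/-- The mean squared error of the gradient estimate for a given reward: variance and bias. -/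
lemma mean_norm_gradEstimate_sub_sq_le (hP : P.PolicyRegular B Lπ) (hB : 0 ≤ B) (hlF : 0 ≤ lF)
    (θ : EuclideanSpace ℝ (Fin d)) {r : EuclideanSpace ℝ (S × A)} (hr : ‖r‖ ≤ lF) {N : ℕ}
    (hN : 0 < N) (H : ℕ) :
    (((P.traj θ H).iid N).mean fun τ => ‖P.gradEstimate θ r τ - P.objGrad θ‖ ^ 2) ≤
      (lF * B / (1 - P.disc)) ^ 2 / N
        + 2 * (lF * B / (1 - P.disc)) ^ 2 * (P.disc ^ H * (H + 1)) ^ 2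
        + 2 * (B / (1 - P.disc)) ^ 2 * ‖r - gradient P.utility (P.occ θ)‖ ^ 2 := by
  have hγ : 0 < 1 - P.disc := sub_pos.2 P.disc_lt_one
  have hN' : (N : ℝ) ≠ 0 := by positivity
  set f : (Fin H → S × A) → EuclideanSpace ℝ (Fin d) := fun τ => (1 - P.disc) • P.pgEstimate τ θ r
    with hf
  set μ := (P.traj θ H).mean f with hμ
  have hmean : (((P.traj θ H).iid N).mean fun τ => P.gradEstimate θ r τ - μ) = 0 := by
    have h0 : P.gradEstimate (N := N) (H := H) θ r = fun τ => (N : ℝ)⁻¹ • ∑ i, f (τ i) := rfl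
    rw [PMF.mean_sub, PMF.mean_const, h0, PMF.mean_smul,
      PMF.mean_iid_sum (P.traj θ H) f, smul_smul, inv_mul_cancel₀ hN', one_smul, sub_self]
  have h1 := ((P.traj θ H).iid N).mean_norm_add_sq (fun τ => P.gradEstimate θ r τ - μ)
    (μ - P.objGrad θ)
  rw [hmean, inner_zero_left, mul_zero, add_zero] at h1
  simp only [sub_add_sub_cancel] at h1
  have hvar : (((P.traj θ H).iid N).mean fun τ => ‖P.gradEstimate θ r τ - μ‖ ^ 2) ≤
      (lF * B / (1 - P.disc)) ^ 2 / N := by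
    refine ((P.traj θ H).mean_iid_norm_average_sub_sq_le f hN).trans
      (div_le_div_of_nonneg_right ?_ (Nat.cast_nonneg N))
    refine ((P.traj θ H).mean_norm_sub_mean_sq_le f).trans ?_
    rw [← (P.traj θ H).mean_const ((lF * B / (1 - P.disc)) ^ 2)]
    refine PMF.mean_mono _ fun τ _ => pow_le_pow_left₀ (norm_nonneg _) ?_ 2
    rw [hf, norm_smul, Real.norm_of_nonneg hγ.le]
    refine (mul_le_mul_of_nonneg_left (norm_pgEstimate_le hP hB hlF
      (fun x => (abs_apply_le_norm _ x).trans hr) τ θ) hγ.le).trans (le_of_eq ?_)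
    field_simp
  have hbias := pow_le_pow_left₀ (norm_nonneg _)
    (norm_mean_pgEstimate_sub_objGrad_le hP hB hlF θ hr H) 2
  rw [h1]
  have h2 := add_sq_le (a := lF * (B / (1 - P.disc) * (P.disc ^ H * (H + 1))))
    (b := ‖r - gradient P.utility (P.occ θ)‖ * (B / (1 - P.disc)))
  calc _ ≤ (lF * B / (1 - P.disc)) ^ 2 / N
        + 2 * ((lF * (B / (1 - P.disc) * (P.disc ^ H * (H + 1)))) ^ 2
          + (‖r - gradient P.utility (P.occ θ)‖ * (B / (1 - P.disc))) ^ 2) :=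
        add_le_add hvar (hbias.trans h2)
    _ = _ := by ring

lemma withPolicy_apply (P : RLGU S A d m) (q : PMF S) (θ : EuclideanSpace ℝ (Fin d)) (x : S × A) :
    P.withPolicy q θ x = (q x.1).toReal * P.actProb θ x := rfl

lemma norm_withPolicy_sub_occ_le (P : RLGU S A d m) (q : PMF S) (θ : EuclideanSpace ℝ (Fin d)) :
    ‖P.withPolicy q θ - P.occ θ‖ ≤ ∑ s, |(q s).toReal - (P.stateOcc θ s).toReal| := by
  refine (norm_le_sum_abs _).trans (le_of_eq ?_)
  rw [← P.sum_actProb_mul θ]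
  refine Finset.sum_congr rfl fun x _ => ?_
  rw [PiLp.sub_apply, occ, withPolicy_apply, withPolicy_apply, ← sub_mul, abs_mul,
    abs_of_nonneg (P.actProb_nonneg θ x), mul_comm]

/-- The mean squared error of the gradient estimate, given a bound `R` for the risk of the estimate
of the state occupancy measure. -/
lemma mean_mean_norm_gradEstimate_sub_sq_le (hC : P.ClassRegular Bω BL)
    (hP : P.PolicyRegular B Lπ) (hU : P.UtilitySmooth lF LF) (hB : 0 ≤ B) (hlF : 0 ≤ lF)
    (θ : EuclideanSpace ℝ (Fin d)) {n N : ℕ} (hN : 0 < N) (H : ℕ)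
    (est : (Fin n → S) → Fin m → ℝ) (hest : ∀ D, est D ∈ P.params) {R : ℝ}
    (hR : (((P.stateOcc θ).iid n).mean fun D =>
      (∑ s, |(P.density (est D) s).toReal - (P.stateOcc θ s).toReal|) ^ 2) ≤ R) :
    (((P.stateOcc θ).iid n).mean fun D => ((P.traj θ H).iid N).mean fun τ =>
      ‖P.gradEstimate θ (gradient P.utility (P.withPolicy (P.density (est D)) θ)) τ
        - P.objGrad θ‖ ^ 2) ≤
      (lF * B / (1 - P.disc)) ^ 2 / N
        + 2 * (lF * B / (1 - P.disc)) ^ 2 * (P.disc ^ H * (H + 1)) ^ 2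
        + 2 * (B * LF / (1 - P.disc)) ^ 2 * R := by
  refine le_trans (PMF.mean_mono _ (g := fun D => (lF * B / (1 - P.disc)) ^ 2 / N
        + 2 * (lF * B / (1 - P.disc)) ^ 2 * (P.disc ^ H * (H + 1)) ^ 2
        + 2 * (B * LF / (1 - P.disc)) ^ 2 *
          (∑ s, |(P.density (est D) s).toReal - (P.stateOcc θ s).toReal|) ^ 2) fun D _ => ?_) ?_
  · have hm : P.withPolicy (P.density (est D)) θ ∈ P.measureClass := ⟨est D, hest D, θ, rfl⟩
    refine (mean_norm_gradEstimate_sub_sq_le hP hB hlF θ (hU.gradient_bounded _ hm) hN H).trans ?_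
    refine add_le_add le_rfl ?_
    have h1 := (hU.gradient_lipschitz _ hm _ (occ_mem_measureClass hC θ))
    have hLF : 0 ≤ LF * ‖P.withPolicy (P.density (est D)) θ - P.occ θ‖ := (norm_nonneg _).trans h1
    have h2 := pow_le_pow_left₀ (norm_nonneg _) h1 2
    have h3 := pow_le_pow_left₀ (norm_nonneg _)
      (norm_withPolicy_sub_occ_le P (P.density (est D)) θ) 2
    calc _ ≤ 2 * (B / (1 - P.disc)) ^ 2 *
          (LF * ‖P.withPolicy (P.density (est D)) θ - P.occ θ‖) ^ 2 := by gcongr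
      _ = 2 * (B * LF / (1 - P.disc)) ^ 2 *
          ‖P.withPolicy (P.density (est D)) θ - P.occ θ‖ ^ 2 := by ring
      _ ≤ _ := by gcongr
  · rw [PMF.mean_add, PMF.mean_const, PMF.mean_const_mul]
    gcongr

/-- The ascent inequality of an inexact gradient step, in which the curvature term is absorbed by
the squared length of the estimate `g` of the gradient. -/
lemma objective_add_smul_ge (hC : P.ClassRegular Bω BL) (hP : P.PolicyRegular B Lπ)
    (hU : P.UtilitySmooth lF LF) (hB : 0 ≤ B) (hlF : 0 ≤ lF) (hLF : 0 ≤ LF) {η : ℝ} (hη : 0 ≤ η)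
    (hηL : η * ((1 - P.disc) * smoothnessConst P.disc B Lπ lF LF) ≤ 1 / 2)
    (θ g : EuclideanSpace ℝ (Fin d)) :
    P.objective θ + η / 2 * (‖P.objGrad θ‖ ^ 2 - ‖g - P.objGrad θ‖ ^ 2) ≤
      P.objective (θ + η • g) := by
  set L := (1 - P.disc) * smoothnessConst P.disc B Lπ lF LF with hL
  have h1 : ‖P.objective (θ + η • g) - P.objective θ
      - innerSL ℝ (P.objGrad θ) (θ + η • g - θ)‖ ≤ L * ‖η • g‖ * ‖θ + η • g - θ‖ := by
    refine (convex_segment θ (θ + η • g)).norm_image_sub_le_of_norm_hasFDerivWithin_le'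
      (fun φ _ => (hasFDerivAt_objective hC hP hU φ).hasFDerivWithinAt) (fun φ hφ => ?_)
      (left_mem_segment ℝ _ _) (right_mem_segment ℝ _ _)
    rw [← map_sub, innerSL_apply_norm]
    refine (norm_objGrad_sub_le hC hP hU hB hlF hLF φ θ).trans ?_
    by_cases h0 : φ = θ
    · rw [h0, sub_self, norm_zero, mul_zero]
      by_cases hg : η • g = 0
      · simp [hg]
      have h2 := norm_objGrad_sub_le hC hP hU hB hlF hLF (θ + η • g) θ
      rw [add_sub_cancel_left] at h2
      exact (norm_nonneg _).trans h2
    have h2 := norm_objGrad_sub_le hC hP hU hB hlF hLF φ θ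
    have hL0 : 0 ≤ L := nonneg_of_mul_nonneg_left ((norm_nonneg _).trans h2)
      (norm_pos_iff.2 (sub_ne_zero.2 h0))
    refine mul_le_mul_of_nonneg_left ?_ hL0
    have h3 := norm_sub_le_of_mem_segment hφ
    rwa [add_sub_cancel_left] at h3
  rw [add_sub_cancel_left, innerSL_apply_apply, real_inner_smul_right, Real.norm_eq_abs, norm_smul,
    Real.norm_of_nonneg hη] at h1
  have h2 := (abs_le.1 h1).1
  have h3 := norm_sub_sq_real g (P.objGrad θ)
  rw [real_inner_comm] at h3
  have h4 : L * (η * ‖g‖) * (η * ‖g‖) ≤ η / 2 * ‖g‖ ^ 2 := by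
    have := mul_le_mul_of_nonneg_right hηL (by positivity : 0 ≤ η * ‖g‖ ^ 2)
    linarith
  rw [h3]
  linarith

lemma update_eq (P : RLGU S A d m) (α : ℝ) {N H : ℕ} (θ : EuclideanSpace ℝ (Fin d))
    (ω : Fin m → ℝ) (τ : Fin N → Fin H → S × A) :
    P.update α θ ω τ = θ + (α / (1 - P.disc)) •
      P.gradEstimate θ (gradient P.utility (P.withPolicy (P.density ω) θ)) τ := by
  have hγ : 1 - P.disc ≠ 0 := (sub_pos.2 P.disc_lt_one).ne'
  rw [update, gradEstimate, ← Finset.smul_sum, smul_smul, smul_smul]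
  congr 2
  field_simp

/-- Expected progress of one iteration towards an upper bound `J` of the objective. -/
lemma expect_step_add_le (hC : P.ClassRegular Bω BL) (hP : P.PolicyRegular B Lπ)
    (hU : P.UtilitySmooth lF LF) (hB : 0 ≤ B) (hlF : 0 ≤ lF) (hLF : 0 ≤ LF) {α : ℝ} (hα : 0 ≤ α)
    (hαL : α * smoothnessConst P.disc B Lπ lF LF ≤ 1 / 2) {J : ℝ} (hJ : ∀ θ, P.objective θ ≤ J)
    {N H n : ℕ} (est : EuclideanSpace ℝ (Fin d) → (Fin n → S) → Fin m → ℝ)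
    (θ : EuclideanSpace ℝ (Fin d)) {σ : ℝ}
    (hσ : (((P.stateOcc θ).iid n).mean fun D => ((P.traj θ H).iid N).mean fun τ =>
      ‖P.gradEstimate θ (gradient P.utility (P.withPolicy (P.density (est θ D)) θ)) τ
        - P.objGrad θ‖ ^ 2) ≤ σ) :
    (P.step α N H est θ).expect (fun φ => J - P.objective φ)
        + ENNReal.ofReal (α / (1 - P.disc) / 2 * ‖P.objGrad θ‖ ^ 2) ≤
      ENNReal.ofReal (J - P.objective θ) + ENNReal.ofReal (α / (1 - P.disc) / 2 * σ) := by
  have hγ : 0 < 1 - P.disc := sub_pos.2 P.disc_lt_one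
  set η := α / (1 - P.disc) with hη
  have hη0 : 0 ≤ η := by positivity
  have hηL : η * ((1 - P.disc) * smoothnessConst P.disc B Lπ lF LF) ≤ 1 / 2 := by
    refine le_trans (le_of_eq ?_) hαL
    rw [hη]
    field_simp
  have hJ0 : ∀ φ, 0 ≤ J - P.objective φ := fun φ => sub_nonneg.2 (hJ φ)
  set Q := (P.stateOcc θ).iid n
  set Q' := (P.traj θ H).iid N
  set e : (Fin n → S) → (Fin N → Fin H → S × A) → ℝ := fun D τ =>
    ‖P.gradEstimate θ (gradient P.utility (P.withPolicy (P.density (est θ D)) θ)) τ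
        - P.objGrad θ‖ ^ 2 with he
  set u : (Fin n → S) → (Fin N → Fin H → S × A) → ℝ := fun D τ =>
    J - P.objective (P.update α θ (est θ D) τ) with hu
  have h1 : (P.step α N H est θ).expect (fun φ => J - P.objective φ) =
      ENNReal.ofReal (Q.mean fun D => Q'.mean (u D)) := by
    rw [step, PMF.expect_bind, ← PMF.expect_eq_ofReal_mean _ fun D =>
      PMF.mean_nonneg _ fun τ => hJ0 _, PMF.expect]
    refine tsum_congr fun D => ?_
    rw [PMF.expect_map]
    congr 1
    exact PMF.expect_eq_ofReal_mean Q' fun τ => hJ0 _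
  have h2 : ∀ D τ, u D τ ≤ (J - P.objective θ - η / 2 * ‖P.objGrad θ‖ ^ 2) + η / 2 * e D τ := by
    intro D τ
    have := objective_add_smul_ge hC hP hU hB hlF hLF hη0 hηL θ
      (P.gradEstimate θ (gradient P.utility (P.withPolicy (P.density (est θ D)) θ)) τ)
    rw [← update_eq] at this
    simp only [hu, he]
    linarith
  have h3 : (Q.mean fun D => Q'.mean (u D)) ≤
      (J - P.objective θ - η / 2 * ‖P.objGrad θ‖ ^ 2) + η / 2 * Q.mean fun D => Q'.mean (e D) := by
    refine (PMF.mean_mono _ fun D _ => PMF.mean_mono _ fun τ _ => h2 D τ).trans (le_of_eq ?_)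
    simp only [PMF.mean_add, PMF.mean_const, PMF.mean_const_mul]
  have h0 : 0 ≤ σ := (PMF.mean_nonneg _ fun D => PMF.mean_nonneg _ fun τ => sq_nonneg _).trans hσ
  rw [h1, ← ENNReal.ofReal_add (PMF.mean_nonneg _ fun D => PMF.mean_nonneg _ fun τ => hJ0 _)
    (by positivity), ← ENNReal.ofReal_add (hJ0 θ) (by positivity)]
  refine ENNReal.ofReal_le_ofReal ?_
  have h4 := mul_le_mul_of_nonneg_left hσ (by positivity : 0 ≤ η / 2)
  linarith

/-! ### The whole run -/

/-- Telescoping the expected progress of the iterations. -/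
lemma expect_iterLaw_add_sum_le {α : ℝ} {N H n : ℕ}
    {est : ℕ → EuclideanSpace ℝ (Fin d) → (Fin n → S) → Fin m → ℝ}
    {V b : EuclideanSpace ℝ (Fin d) → ℝ} {c : ENNReal}
    (h : ∀ t θ, (P.step α N H (est t) θ).expect V + ENNReal.ofReal (b θ) ≤
      ENNReal.ofReal (V θ) + c) (θ₀ : EuclideanSpace ℝ (Fin d)) (T : ℕ) :
    (P.iterLaw α N H est θ₀ T).expect V
        + ∑ t ∈ Finset.range T, (P.iterLaw α N H est θ₀ t).expect b ≤
      ENNReal.ofReal (V θ₀) + T * c := by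
  induction T with
  | zero => simp [iterLaw, PMF.expect_pure]
  | succ T ih =>
    have h1 : (P.iterLaw α N H est θ₀ (T + 1)).expect V + (P.iterLaw α N H est θ₀ T).expect b ≤
        (P.iterLaw α N H est θ₀ T).expect V + c := by
      rw [iterLaw, PMF.expect_bind]
      simp only [PMF.expect]
      rw [← ENNReal.tsum_add]
      calc _ ≤ ∑' θ, (P.iterLaw α N H est θ₀ T θ * ENNReal.ofReal (V θ)
            + P.iterLaw α N H est θ₀ T θ * c) := by
            refine ENNReal.tsum_le_tsum fun θ => ?_
            rw [← mul_add, ← mul_add]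
            exact mul_le_mul_right (h T θ) _
        _ = _ := by rw [ENNReal.tsum_add, ENNReal.tsum_mul_right, PMF.tsum_coe, one_mul]
    rw [Finset.sum_range_succ]
    calc _ = ((P.iterLaw α N H est θ₀ (T + 1)).expect V + (P.iterLaw α N H est θ₀ T).expect b)
          + ∑ t ∈ Finset.range T, (P.iterLaw α N H est θ₀ t).expect b := by ring
      _ ≤ ((P.iterLaw α N H est θ₀ T).expect V + c)
          + ∑ t ∈ Finset.range T, (P.iterLaw α N H est θ₀ t).expect b := by gcongr
      _ = ((P.iterLaw α N H est θ₀ T).expect V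
          + ∑ t ∈ Finset.range T, (P.iterLaw α N H est θ₀ t).expect b) + c := by ring
      _ ≤ ENNReal.ofReal (V θ₀) + T * c + c := by gcongr
      _ = _ := by push_cast; ring

lemma natCast_mul_expect_outputLaw (P : RLGU S A d m) (α : ℝ) (N H : ℕ) {n : ℕ}
    (est : ℕ → EuclideanSpace ℝ (Fin d) → (Fin n → S) → Fin m → ℝ)
    (θ₀ : EuclideanSpace ℝ (Fin d)) (T : ℕ) (hT : 1 ≤ T) (f : EuclideanSpace ℝ (Fin d) → ℝ) :
    T * (P.outputLaw α N H est θ₀ T hT).expect f =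
      ∑ t ∈ Finset.Icc 1 T, (P.iterLaw α N H est θ₀ t).expect f := by
  rw [outputLaw, PMF.expect_bind, tsum_eq_sum (s := Finset.Icc 1 T) fun t ht => by
    rw [PMF.uniformOfFinset_apply_of_notMem _ ht, zero_mul], Finset.mul_sum]
  refine Finset.sum_congr rfl fun t ht => ?_
  rw [PMF.uniformOfFinset_apply_of_mem _ ht, Nat.card_Icc, Nat.add_sub_cancel, ← mul_assoc,
    ENNReal.mul_inv_cancel (by positivity) (ENNReal.natCast_ne_top T), one_mul]

/-- Average stationarity of the run, given a bound `σ` for the mean squared error of every gradient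
estimate. The output is uniform on `{1, …, T}`, so the progress of `T + 1` iterations is used. -/
lemma expect_outputLaw_le (hC : P.ClassRegular Bω BL) (hP : P.PolicyRegular B Lπ)
    (hU : P.UtilitySmooth lF LF) (hB : 0 ≤ B) (hlF : 0 ≤ lF) (hLF : 0 ≤ LF) {α : ℝ} (hα : 0 < α)
    (hαL : α * smoothnessConst P.disc B Lπ lF LF ≤ 1 / 2) {Δ : ℝ}
    {θ₀ : EuclideanSpace ℝ (Fin d)} (hΔ : ∀ θ, P.objective θ ≤ P.objective θ₀ + Δ)
    {N H n : ℕ} (est : ℕ → EuclideanSpace ℝ (Fin d) → (Fin n → S) → Fin m → ℝ) {σ : ℝ}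
    (hσ : ∀ t θ, (((P.stateOcc θ).iid n).mean fun D => ((P.traj θ H).iid N).mean fun τ =>
      ‖P.gradEstimate θ (gradient P.utility (P.withPolicy (P.density (est t θ D)) θ)) τ
        - P.objGrad θ‖ ^ 2) ≤ σ) {T : ℕ} (hT : 1 ≤ T) {ε : ℝ}
    (hTε : 4 * Δ * (1 - P.disc) / α ≤ ε * T) (hσε : σ ≤ ε / 4) :
    (P.outputLaw α N H est θ₀ T hT).expect (fun θ => ‖P.objGrad θ‖ ^ 2) ≤ ENNReal.ofReal ε := by
  have hγ : 0 < 1 - P.disc := sub_pos.2 P.disc_lt_one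
  set η := α / (1 - P.disc) / 2 with hη
  have hη0 : 0 < η := by positivity
  have hT' : (1 : ℝ) ≤ T := by exact_mod_cast hT
  have hΔ0 : 0 ≤ Δ := by linarith [hΔ θ₀]
  have hσ0 : 0 ≤ σ :=
    (PMF.mean_nonneg _ fun D => PMF.mean_nonneg _ fun τ => sq_nonneg _).trans (hσ 0 θ₀)
  have h1 := expect_iterLaw_add_sum_le (fun t θ =>
    expect_step_add_le hC hP hU hB hlF hLF hα.le hαL hΔ (est t) θ (hσ t θ)) θ₀ (T + 1)
  rw [← hη, add_sub_cancel_left] at h1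
  simp only [PMF.expect_const_mul _ hη0.le, ← Finset.mul_sum] at h1
  have h2 : ENNReal.ofReal η *
      (T * (P.outputLaw α N H est θ₀ T hT).expect (fun θ => ‖P.objGrad θ‖ ^ 2)) ≤
      ENNReal.ofReal η * (T * ENNReal.ofReal ε) := by
    rw [natCast_mul_expect_outputLaw]
    have hsub : Finset.Icc 1 T ⊆ Finset.range (T + 1) := fun t ht => by
      rw [Finset.mem_Icc] at ht
      rw [Finset.mem_range]
      omega
    refine (mul_le_mul_right (Finset.sum_le_sum_of_subset hsub) _).trans
      (le_add_self.trans (h1.trans ?_))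
    rw [← ENNReal.ofReal_natCast (T + 1), ← ENNReal.ofReal_natCast T,
      ← ENNReal.ofReal_mul (by positivity), ← ENNReal.ofReal_mul (by positivity),
      ← ENNReal.ofReal_mul (by positivity), ← ENNReal.ofReal_add hΔ0 (by positivity)]
    refine ENNReal.ofReal_le_ofReal ?_
    push_cast
    have h3 : Δ ≤ η * (T * ε) / 2 := by
      have h4 := mul_le_mul_of_nonneg_left hTε (by positivity : 0 ≤ η / 2)
      have h5 : η / 2 * (4 * Δ * (1 - P.disc) / α) = Δ := by rw [hη]; field_simp; ring
      rw [h5] at h4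
      linarith
    have h6 : ((T : ℝ) + 1) * (η * σ) ≤ 2 * T * (η * (ε / 4)) := by gcongr; linarith
    linarith
  have h3 := (ENNReal.mul_le_mul_iff_right (by simpa using hη0) ENNReal.ofReal_ne_top).1 h2
  exact (ENNReal.mul_le_mul_iff_right (by simpa using (by omega : T ≠ 0))
    (ENNReal.natCast_ne_top T)).1 h3

end RLGU

/-! ### Sample sizes -/

lemma one_le_log_two_add {x : ℝ} (hx : 1 ≤ x) : 1 ≤ Real.log (2 + x) := by
  rw [Real.le_log_iff_exp_le (by linarith)]
  linarith [Real.exp_one_lt_d9]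

lemma pow_le_div_of_horizon {γ K C ε : ℝ} (h0 : 0 < γ) (h1 : γ < 1) (hK : 1 ≤ K)
    (hC : 1 + Real.log K ≤ C * Real.log (1 / γ)) (hε0 : 0 < ε) (hε1 : ε ≤ 1) {H : ℕ}
    (hH : C * (1 + Real.log (1 / ε)) ≤ H) : γ ^ H ≤ ε / K := by
  have hlK := Real.log_nonneg hK
  have hlε : 0 ≤ Real.log (1 / ε) := Real.log_nonneg (by rwa [le_div_iff₀ hε0, one_mul])
  have hlγ : 0 < Real.log (1 / γ) := Real.log_pos (by rwa [lt_div_iff₀ h0, one_mul])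
  rw [← Real.log_le_log_iff (by positivity) (by positivity), Real.log_pow,
    Real.log_div hε0.ne' (by positivity)]
  have h2 := mul_le_mul_of_nonneg_right hH hlγ.le
  have h3 := mul_le_mul_of_nonneg_right hC (by linarith : 0 ≤ 1 + Real.log (1 / ε))
  have h4 := mul_nonneg hlK hlε
  rw [one_div, Real.log_inv] at h2 h3 hlε h4
  rw [one_div, Real.log_inv] at h2 h3
  nlinarith

/-- The truncation error `γ^H (H + 1)`, squared, decays like `γ^H`. -/
lemma sq_pow_mul_add_one_le {γ : ℝ} (h0 : 0 < γ) (h1 : γ < 1) (H : ℕ) :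
    (γ ^ H * (H + 1)) ^ 2 ≤ γ ^ H * (2 / (1 - γ) ^ 3) := by
  have hs := hasSum_pow_mul_add_two_mul_add_one h0 h1
  have h2 := le_hasSum hs H fun t _ => by positivity
  calc _ = γ ^ H * (γ ^ H * (((H : ℝ) + 1) * (H + 1))) := by ring
    _ ≤ γ ^ H * (γ ^ H * (((H : ℝ) + 2) * (H + 1))) := by gcongr; norm_num
    _ ≤ _ := by gcongr

/-- The sample size needed for the risk bound with logarithm. With `x = m / ε` and `n = x y`, the
risk is at most a multiple of `ε (log n + a) / y`, where `log n = log x + log y`, `log y ≤ 2 √y`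
and `y ≥ C log (2 + x)`. -/
lemma log_risk_le {b c K C ε : ℝ} (hb : 0 ≤ b) (hc : 0 ≤ c) (hK : 0 < K) (hC1 : 1 ≤ C)
    (hC : (8 * K * (Real.log (b + 1) + c + 6)) ^ 2 ≤ C) {m n : ℕ} (hm : 1 ≤ m) (hε0 : 0 < ε)
    (hε1 : ε ≤ 1) (hn : C * m / ε * Real.log (2 + m / ε) ≤ n) :
    8 * (m * Real.log (b * n ^ 2 + 1) / n + c / n) ≤ ε / K := by
  have hm' : (1 : ℝ) ≤ m := by exact_mod_cast hm
  set x : ℝ := m / ε with hx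
  have hx1 : 1 ≤ x := by rw [hx, le_div_iff₀ hε0]; linarith
  have hl := one_le_log_two_add hx1
  have hn0 : (0 : ℝ) < n := lt_of_lt_of_le (by positivity) hn
  have hn1 : (1 : ℝ) ≤ n := by exact_mod_cast Nat.one_le_iff_ne_zero.2 (by rintro rfl; simp at hn0)
  set y : ℝ := n / x with hy
  have hxy : (n : ℝ) = x * y := by rw [hy]; field_simp
  have hy1 : C * Real.log (2 + x) ≤ y := by
    rw [hy, le_div_iff₀ (by positivity)]
    refine le_trans (le_of_eq ?_) hn
    rw [hx]; ring
  have hC0 : 0 < C := by linarith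
  have hCy : C ≤ y := le_trans (by nlinarith) hy1
  have hy0 : 0 < y := hC0.trans_le hCy
  set a := Real.log (b + 1) with ha
  have ha0 : 0 ≤ a := Real.log_nonneg (by linarith)
  have hlog : Real.log (b * n ^ 2 + 1) ≤ a + 2 * Real.log (2 + x) + 4 * √y := by
    have h1 : Real.log (b * n ^ 2 + 1) ≤ Real.log ((b + 1) * (n : ℝ) ^ 2) := by
      refine Real.log_le_log (by positivity) ?_
      nlinarith
    rw [Real.log_mul (by positivity) (by positivity), Real.log_pow, hxy,
      Real.log_mul (by positivity) hy0.ne'] at h1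
    have h2 : Real.log x ≤ Real.log (2 + x) := Real.log_le_log (by linarith) (by linarith)
    have h3 := Real.log_le_sub_one_of_pos (Real.sqrt_pos.2 hy0)
    rw [Real.log_sqrt hy0.le] at h3
    rw [hxy]
    push_cast at h1
    linarith
  have hsC : 0 < √C := Real.sqrt_pos.2 hC0
  have hsy : 0 < √y := Real.sqrt_pos.2 hy0
  have hsC1 : 1 ≤ √C := Real.one_le_sqrt.2 hC1
  have hCC : √C * √C = C := Real.mul_self_sqrt hC0.le
  have hyy : √y * √y = y := Real.mul_self_sqrt hy0.le
  have hsCy : √C ≤ √y := Real.sqrt_le_sqrt hCy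
  have h1 : a + c ≤ (a + c) * (y / √C) := by
    refine le_mul_of_one_le_right (by positivity) ?_
    rw [one_le_div hsC]
    nlinarith
  have h2 : Real.log (2 + x) ≤ y / √C := by
    rw [le_div_iff₀ hsC]
    nlinarith
  have h3 : √y ≤ y / √C := by
    rw [le_div_iff₀ hsC]
    nlinarith
  have h4 : a + c + 6 ≤ √C / (8 * K) := by
    rw [le_div_iff₀ (by positivity), mul_comm]
    exact Real.le_sqrt_of_sq_le hC
  have hmn : (m : ℝ) / n = ε / y := by rw [hxy, hx]; field_simp
  calc 8 * (m * Real.log (b * n ^ 2 + 1) / n + c / n)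
      ≤ 8 * (m * (a + 2 * Real.log (2 + x) + 4 * √y) / n + m * c / n) := by
        gcongr
        exact le_mul_of_one_le_left hc hm'
    _ = 8 * (m / n) * (a + c + 2 * Real.log (2 + x) + 4 * √y) := by ring
    _ ≤ 8 * (ε / y) * ((a + c + 6) * (y / √C)) := by
        rw [hmn]
        gcongr
        linarith
    _ ≤ 8 * (ε / y) * (√C / (8 * K) * (y / √C)) := by gcongr
    _ = ε / K := by field_simp

/-- The total sample complexity, for a number `n` of state samples that is at least `C / ε`. -/
lemma ceil_mul_le {C ε z : ℝ} (hC : 1 ≤ C) (hε0 : 0 < ε) (hε1 : ε ≤ 1) (hz : 1 ≤ z) :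
    ((⌈C / ε⌉₊ * (⌈C / ε⌉₊ + ⌈C / ε * z⌉₊) : ℕ) : ℝ) ≤ 8 * C ^ 2 / ε ^ 2 * z := by
  have hceil : ∀ w : ℝ, 1 ≤ w → (⌈w⌉₊ : ℝ) ≤ 2 * w := fun w hw => by
    have := Nat.ceil_lt_add_one (by linarith : 0 ≤ w)
    linarith
  have h1 : 1 ≤ C / ε := by rw [le_div_iff₀ hε0]; linarith
  have h2 : 1 ≤ C / ε * z := by nlinarith
  push_cast
  calc _ ≤ 2 * (C / ε) * (2 * (C / ε) + 2 * (C / ε * z)) := by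
        gcongr
        · exact hceil _ h1
        · exact hceil _ h1
        · exact hceil _ h2
    _ ≤ 2 * (C / ε) * (2 * (C / ε * z) + 2 * (C / ε * z)) := by
        gcongr
        exact le_mul_of_one_le_right (by linarith) hz
    _ = _ := by field_simp; ring

namespace RLGU

variable {S A : Type*} [Fintype S] [Fintype A] {d m : ℕ} {P : RLGU S A d m}
  {B Lπ lF LF Bω BL : ℝ}

/-- The risk of the maximum likelihood estimate of the state occupancy measure at the two sample
sizes of the theorem. -/
lemma mean_mle_stateOcc_le (hC : P.ClassRegular Bω BL) (hBω : 0 ≤ Bω) (hBL : 0 ≤ BL)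
    {K C ε : ℝ} (hK : 0 < K) (hC1 : 1 ≤ C) (hC2 : 16 * K ≤ C)
    (hC3 : (8 * K * (Real.log (2 * Bω + 1) + √(2 * BL) + 6)) ^ 2 ≤ C) (hm : 1 ≤ m) (hε0 : 0 < ε)
    (hε1 : ε ≤ 1) {n : ℕ}
    (hn : C * m / ε * Real.log (2 + m / ε) ≤ n ∨ C * Fintype.card S * m / ε ≤ n)
    (est : (Fin n → S) → Fin m → ℝ) (hest : ∀ D, P.IsMLE D (est D))
    (θ : EuclideanSpace ℝ (Fin d)) :
    (((P.stateOcc θ).iid n).mean fun D =>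
      (∑ s, |(P.density (est D) s).toReal - (P.stateOcc θ s).toReal|) ^ 2) ≤ ε / K := by
  obtain ⟨ω₀, hω₀, hocc⟩ := hC.realizable θ
  rw [← hocc]
  have hm' : (1 : ℝ) ≤ m := by exact_mod_cast hm
  rcases hn with hn | hn
  · have h1 : 1 ≤ (m : ℝ) / ε := by rw [le_div_iff₀ hε0]; linarith
    have hl := one_le_log_two_add h1
    have hn0 : (0 : ℝ) < n := lt_of_lt_of_le (by positivity) hn
    exact (mean_mle_l1_sq_le hC hBω hBL (by exact_mod_cast hn0) est hest hω₀).trans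
      (log_risk_le (by positivity) (Real.sqrt_nonneg _) hK hC1 hC3 hm hε0 hε1 hn)
  · obtain ⟨s, -⟩ := P.init.support_nonempty
    have hS : (0 : ℝ) < Fintype.card S := by exact_mod_cast Fintype.card_pos_iff.2 ⟨s⟩
    have hn0 : (0 : ℝ) < n := lt_of_lt_of_le (by positivity) hn
    have hn1 : 0 < n := by exact_mod_cast hn0
    refine ((P.density ω₀).mean_iid_l1_sq_le_card hn1 (fun D => P.density (est D))
      fun D => (hest D).prod_le hn1 hω₀).trans ?_
    rw [div_le_iff₀ hε0] at hn
    rw [← mul_div_assoc, div_le_div_iff₀ hn0 hK]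
    have h1 : Fintype.card S * (16 * K) ≤ Fintype.card S * (C * m) :=
      mul_le_mul_of_nonneg_left (hC2.trans (le_mul_of_one_le_right (by linarith) hm')) hS.le
    nlinarith

/-- The constant of the sample sizes. -/
noncomputable def sampleConst (γ B lF LF Bω BL Δ α : ℝ) : ℝ :=
  1 + 4 * Δ * (1 - γ) / α + 12 * (lF * B / (1 - γ)) ^ 2
    + (1 + Real.log (1 + 48 * (lF * B / (1 - γ)) ^ 2 / (1 - γ) ^ 3)) / Real.log (1 / γ)
    + 16 * (1 + 24 * (B * LF / (1 - γ)) ^ 2)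
    + (8 * (1 + 24 * (B * LF / (1 - γ)) ^ 2) * (Real.log (2 * Bω + 1) + √(2 * BL) + 6)) ^ 2

lemma expect_norm_gradient_sq_le (hC : P.ClassRegular Bω BL) (hP : P.PolicyRegular B Lπ)
    (hU : P.UtilitySmooth lF LF) (hB : 0 ≤ B) (hlF : 0 ≤ lF) (hLF : 0 ≤ LF) (hBω : 0 ≤ Bω)
    (hBL : 0 ≤ BL) {α : ℝ} (hα : 0 < α)
    (hαL : α * smoothnessConst P.disc B Lπ lF LF ≤ 1 / 2) {Δ : ℝ}
    {θ₀ : EuclideanSpace ℝ (Fin d)} (hΔ : ∀ θ, P.objective θ ≤ P.objective θ₀ + Δ)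
    (hm : 1 ≤ m) {ε : ℝ} (hε0 : 0 < ε) (hε1 : ε ≤ 1) {T N H n : ℕ} (hT : 1 ≤ T)
    (est : ℕ → EuclideanSpace ℝ (Fin d) → (Fin n → S) → Fin m → ℝ)
    (hest : ∀ t θ D, P.IsMLE D (est t θ D)) {C : ℝ}
    (hCdef : C = sampleConst P.disc B lF LF Bω BL Δ α) (hTC : C / ε ≤ T) (hNC : C / ε ≤ N)
    (hHC : C * (1 + Real.log (1 / ε)) ≤ H)
    (hnC : C * m / ε * Real.log (2 + m / ε) ≤ n ∨ C * Fintype.card S * m / ε ≤ n) :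
    (P.outputLaw α N H est θ₀ T hT).expect (fun θ => ‖gradient P.objective θ‖ ^ 2) ≤
      ENNReal.ofReal ε := by
  have hγ0 := P.disc_pos
  have hγ1 := P.disc_lt_one
  have hγ : 0 < 1 - P.disc := sub_pos.2 hγ1
  have hΔ0 : 0 ≤ Δ := by linarith [hΔ θ₀]
  set V := (lF * B / (1 - P.disc)) ^ 2 with hV
  set W := (B * LF / (1 - P.disc)) ^ 2 with hW
  set K₁ := 1 + 48 * V / (1 - P.disc) ^ 3 with hK₁
  set K₂ := 1 + 24 * W with hK₂
  have hV0 : 0 ≤ V := sq_nonneg _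
  have hW0 : 0 ≤ W := sq_nonneg _
  have hK₁1 : 1 ≤ K₁ := le_add_of_nonneg_right (by positivity)
  have hlog : 0 < Real.log (1 / P.disc) := Real.log_pos (by rwa [lt_div_iff₀ hγ0, one_mul])
  have hlogK := Real.log_nonneg hK₁1
  -- each summand of the constant is nonnegative, hence a lower bound for it
  have hc1 : 0 ≤ 4 * Δ * (1 - P.disc) / α := by positivity
  have hc2 : 0 ≤ (1 + Real.log K₁) / Real.log (1 / P.disc) := by positivity
  have hc3 : 0 ≤ (8 * K₂ * (Real.log (2 * Bω + 1) + √(2 * BL) + 6)) ^ 2 := sq_nonneg _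
  have hCsum : C = 1 + 4 * Δ * (1 - P.disc) / α + 12 * V
      + (1 + Real.log K₁) / Real.log (1 / P.disc) + 16 * K₂
      + (8 * K₂ * (Real.log (2 * Bω + 1) + √(2 * BL) + 6)) ^ 2 := hCdef
  have hC1 : 1 ≤ C := by linarith
  have hN0 : (0 : ℝ) < N := lt_of_lt_of_le (by positivity) hNC
  have hgrad : ∀ θ, gradient P.objective θ = P.objGrad θ := fun θ =>
    HasGradientAt.gradient (hasFDerivAt_objective hC hP hU θ)
  simp only [hgrad]
  rw [div_le_iff₀ hε0] at hTC hNC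
  refine expect_outputLaw_le hC hP hU hB hlF hLF hα hαL hΔ est (σ := ε / 4) (fun t θ => ?_) hT
    (by linarith) le_rfl
  refine (mean_mean_norm_gradEstimate_sub_sq_le hC hP hU hB hlF θ (by exact_mod_cast hN0) H
    (est t θ) (fun D => (hest t θ D).1) (mean_mle_stateOcc_le hC hBω hBL (K := K₂) (by positivity)
      hC1 (by linarith) (by linarith) hm hε0 hε1 hnC (est t θ) (hest t θ) θ)).trans ?_
  have e1 : V / N ≤ ε / 12 := by
    rw [div_le_div_iff₀ hN0 (by norm_num)]
    linarith
  have e2 : 2 * V * (P.disc ^ H * (H + 1)) ^ 2 ≤ ε / 12 := by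
    have hH : P.disc ^ H ≤ ε / K₁ := pow_le_div_of_horizon hγ0 hγ1 hK₁1 (by
      rw [← div_le_iff₀ hlog]
      linarith) hε0 hε1 hHC
    calc _ ≤ 2 * V * (ε / K₁ * (2 / (1 - P.disc) ^ 3)) := by
          refine mul_le_mul_of_nonneg_left ((sq_pow_mul_add_one_le hγ0 hγ1 H).trans ?_)
            (by positivity)
          gcongr
      _ = ε / 12 * ((48 * V / (1 - P.disc) ^ 3) / K₁) := by ring
      _ ≤ ε / 12 * 1 := by
          gcongr
          rw [div_le_one (by positivity)]
          linarith
      _ = _ := mul_one _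
  have e3 : 2 * W * (ε / K₂) ≤ ε / 12 := by
    calc _ = ε / 12 * (24 * W / K₂) := by ring
      _ ≤ ε / 12 * 1 := by
          gcongr
          rw [div_le_one (by positivity)]
          linarith
      _ = _ := mul_one _
  linarith

end RLGU

theorem corollary1
    (γ B Lπ lF LF Bω BL Δ α : ℝ) (hγ0 : 0 < γ) (hγ1 : γ < 1) (hB : 0 < B) (hLπ : 0 < Lπ)
    (hlF : 0 < lF) (hLF : 0 < LF) (hBω : 0 ≤ Bω) (hBL : 0 ≤ BL) (hΔ : 0 ≤ Δ)
    (hα0 : 0 < α) (hα : α ≤ 1 / (2 * smoothnessConst γ B Lπ lF LF)) :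
    ∃ C C' : ℝ, 0 < C ∧ 0 < C' ∧
      -- sample sizes under which the stationarity guarantee holds
      (∀ (S A : Type*) [Fintype S] [Fintype A] (d m : ℕ) (P : RLGU S A d m)
        (θ₀ : EuclideanSpace ℝ (Fin d)),
        1 ≤ m → P.disc = γ → P.ClassRegular Bω BL → P.PolicyRegular B Lπ →
        P.UtilitySmooth lF LF → (∀ θ, P.objective θ ≤ P.objective θ₀ + Δ) →
        Differentiable ℝ P.objective ∧
        ∀ (ε : ℝ), 0 < ε → ε ≤ 1 →
        ∀ (T N H n : ℕ) (hT : 1 ≤ T)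
          (est : ℕ → EuclideanSpace ℝ (Fin d) → (Fin n → S) → Fin m → ℝ),
          (∀ t θ D, P.IsMLE D (est t θ D)) →
          C / ε ≤ T → C / ε ≤ N → C * (1 + Real.log (1 / ε)) ≤ H →
          (C * m / ε * Real.log (2 + m / ε) ≤ n ∨ C * Fintype.card S * m / ε ≤ n) →
          (P.outputLaw α N H est θ₀ T hT).expect (fun θ => ‖gradient P.objective θ‖ ^ 2)
            ≤ ENNReal.ofReal ε) ∧
      -- total sample complexity `T (N + n)` for the smallest such choices
      (∀ (m : ℕ) (ε : ℝ), 1 ≤ m → 0 < ε → ε ≤ 1 →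
        ((⌈C / ε⌉₊ * (⌈C / ε⌉₊ + ⌈C * m / ε * Real.log (2 + m / ε)⌉₊) : ℕ) : ℝ)
          ≤ C' * m / ε ^ 2 * Real.log (2 + m / ε) ∧
        ∀ k : ℕ, 1 ≤ k →
        ((⌈C / ε⌉₊ * (⌈C / ε⌉₊ + ⌈C * k * m / ε⌉₊) : ℕ) : ℝ) ≤ C' * k * m / ε ^ 2) := by
  have hγ : 0 < 1 - γ := sub_pos.2 hγ1
  have hL : 0 < smoothnessConst γ B Lπ lF LF := by
    unfold smoothnessConst
    positivity
  have hαL : α * smoothnessConst γ B Lπ lF LF ≤ 1 / 2 := by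
    rw [le_div_iff₀ (by positivity)] at hα
    linarith
  set C := RLGU.sampleConst γ B lF LF Bω BL Δ α with hCdef
  have hC1 : 1 ≤ C := by
    have hlog : 0 < Real.log (1 / γ) := Real.log_pos (by rwa [lt_div_iff₀ hγ0, one_mul])
    have hlogK : 0 ≤ Real.log (1 + 48 * (lF * B / (1 - γ)) ^ 2 / (1 - γ) ^ 3) :=
      Real.log_nonneg (le_add_of_nonneg_right (by positivity))
    rw [hCdef, RLGU.sampleConst]
    simp only [add_assoc]
    exact le_add_of_nonneg_right (by positivity)
  refine ⟨C, 8 * C ^ 2, by linarith, by positivity, ?_, fun m ε hm hε0 hε1 => ⟨?_, fun k hk => ?_⟩⟩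
  · intro S A _ _ d m P θ₀ hm hdisc hC hP hU hΔ'
    refine ⟨fun θ => (RLGU.hasFDerivAt_objective hC hP hU θ).differentiableAt, ?_⟩
    intro ε hε0 hε1 T N H n hT est hest hTC hNC hHC hnC
    exact RLGU.expect_norm_gradient_sq_le hC hP hU hB.le hlF.le hLF.le hBω hBL hα0
      (by rwa [hdisc]) hΔ' hm hε0 hε1 hT est hest (by rw [hdisc]) hTC hNC hHC hnC
  · have hm' : (1 : ℝ) ≤ m := by exact_mod_cast hm
    have hx : 1 ≤ (m : ℝ) / ε := by rw [le_div_iff₀ hε0]; linarith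
    have hz : 1 ≤ m * Real.log (2 + m / ε) :=
      one_le_mul_of_one_le_of_one_le hm' (one_le_log_two_add hx)
    have h := ceil_mul_le hC1 hε0 hε1 hz
    rw [show C * m / ε * Real.log (2 + m / ε) = C / ε * (m * Real.log (2 + m / ε)) by ring]
    exact h.trans_eq (by ring)
  · have hm' : (1 : ℝ) ≤ m := by exact_mod_cast hm
    have hk' : (1 : ℝ) ≤ k := by exact_mod_cast hk
    have h := ceil_mul_le hC1 hε0 hε1 (one_le_mul_of_one_le_of_one_le hk' hm')
    rw [show C * k * m / ε = C / ε * (k * m) by ring]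
    exact h.trans_eq (by ring)
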